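/- **Setting.** Let $N\ge 1$ converter nodes, $K\ge 0$ interior nodes and one grounded node be joined by a connected network of R–L lines. The line between nodes $i$ and $j$ has resistance $R_{ij}\ge 0$ and reactance $X_{ij}>0$, and all lines have the same ratio $R_{ij}/X_{ij}=\epsilon$. Put $B_{ij}=1/X_{ij}$ if there is a line and $B_{ij}=0$ otherwise. With the nominal frequency $\omega_0>0$, the line has the admittance $B_{ij}F_\epsilon(s)$, where $$F_\epsilon(s)=\begin{bmatrix} s/\omega_0+\epsilon & -1\\ 1& s/\omega_0+\epsilon\end{bmatrix}^{-1}.$$ Let $\mathbf B\in\mathbb R^{(N+K)\times(N+K)}$ be the grounded Laplacian of the weights $B_{ij}$ and let $\mathbf B_{\rm r}\in\mathbb R^{N\times N}$ be its Kron reduction (Schur complement) to the converter nodes. Let $\mathbf Y_{\rm grid}(s)$ be the Kron reduction to the converter nodes of the grounded Laplacian with the $2\times2$ blocks $B_{ij}F_\epsilon(s)$. Let $\mathbf S={\rm diag}(S_1,\dots,S_N)$ with capacity ratios $S_i>0$, and let $\theta_1,\dots,\theta_N\in\mathbb R$. Let $\mathbf Y_{{\rm C},i}(s)$ be the $2\times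 2$ real rational admittance of the $i$-th converter, and put $\widetilde{\mathbf Y}_{{\rm C},i}(s)=\mathbf Y_{{\rm C},i}(s)F_\epsilon^{-1}(s)$. The multi-converter system is the negative feedback loop $G\#H$ of $$G(s)={\rm diag}\big(e^{J\theta_i}\mathbf Y_{{\rm C},i}(s)e^{-J\theta_i}\big)_{i}\,(I_N\otimes F_\epsilon^{-1}(s)),\qquad H(s)=\Big[(\mathbf S^{-1/2}\otimes I_2)\,\mathbf Y_{\rm grid}(s)\,(\mathbf S^{-1/2}\otimes F_\epsilon^{-1}(s))\Big]^{-1},$$ where $e^{J\theta}$ is the rotation by $\theta$. It is stable if $I+HG$ is invertible and $$\begin{bmatrix}(I+HG)^{-1}&(I+HG)^{-1}H\\ G(I+HG)^{-1}&G(I+HG)^{-1}H\end{bmatrix}\in\mathcal{RH}_\infty$$ (real rational, proper, all poles in the open left half-plane). For a complex matrix $A$, $\overline\sigma(A)$ and $\underline\sigma(A)$ are the largest and smallest singular values. $A$ is sectorial if $x^*Ax\neq0$ for all unit vectors $x$. Then $A=T^*DT$ with $T$ nonsingular and $D$ diagonal unitary, and the phases of $A$ are the arguments of the eigenvalues of $D$,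 chosen such that the largest and smallest phases satisfy $\overline\phi(A)-\underline\phi(A)<\pi$ and $(\overline\phi(A)+\underline\phi(A))/2\in(-\pi,\pi]$. **Corollary (Power grid strength).** Suppose that $\widetilde{\mathbf Y}_{{\rm C},i}\in\mathcal{RH}_\infty$ for all $i$. Then $\mathbf Y_{\rm grid}(s)=\mathbf B_{\rm r}\otimes F_\epsilon(s)$; the matrix $\mathbf S^{-1}\mathbf B_{\rm r}$ has a smallest eigenvalue ${\rm gSCR}:=\lambda_1(\mathbf S^{-1}\mathbf B_{\rm r})$, and ${\rm gSCR}=\underline\sigma(\mathbf S^{-1/2}\mathbf B_{\rm r}\mathbf S^{-1/2})$. Moreover, the multi-converter system is stable if for each $\omega\in[0,\infty]$ at least one of the following holds (at $\omega=\infty$, the value is the limit): i) $\max_i\overline\sigma(\widetilde{\mathbf Y}_{{\rm C},i}(j\omega))<{\rm gSCR}$; ii) all $\widetilde{\mathbf Y}_{{\rm C},i}(j\omega)$ are sectorial, $\max_i\overline\phi(\widetilde{\mathbf Y}_{{\rm C},i}(j\omega))<\pi$, $\min_i\underline\phi(\widetilde{\mathbf Y}_{{\rm C},i}(j\omega))>-\pi$,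 and $\max_i\overline\phi(\widetilde{\mathbf Y}_{{\rm C},i}(j\omega))-\min_i\underline\phi(\widetilde{\mathbf Y}_{{\rm C},i}(j\omega))<\pi$. -/

import Mathlib

open scoped Kronecker ENNReal Matrix

noncomputable section

namespace PowerGrid

/-! ### Real rational transfer functions -/

/-- Scalar real rational transfer functions in the Laplace variable `s = RatFunc.X`. -/
abbrev TF : Type := RatFunc ℝ

/-- `f` belongs to `RH∞`: it is proper and all its poles (the roots of the reduced denominator)
lie in the open left half-plane. -/
def IsRHInfEntry (f : TF) : Prop :=
  f.num.natDegree ≤ f.denom.natDegree ∧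
    ∀ z : ℂ, Polynomial.aeval z f.denom = 0 → z.re < 0

/-- A transfer function matrix belongs to `RH∞` if all its entries do. -/
def IsRHInf {m n : Type*} (G : Matrix m n TF) : Prop :=
  ∀ i j, IsRHInfEntry (G i j)

/-- The value `f(jω)` of a proper transfer function at a frequency `ω ∈ [0, ∞]`; at `ω = ∞` it is
the limit of `f(s)` as `|s| → ∞` (for `f = num / denom` proper: the coefficient of
`s ^ deg denom` in `num` divided by the leading coefficient of `denom`). -/
def freqValue (f : TF) (ω : ℝ≥0∞) : ℂ :=
  if ω = ⊤ then ((f.num.coeff f.denom.natDegree / f.denom.leadingCoeff : ℝ) : ℂ)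
  else RatFunc.eval (algebraMap ℝ ℂ) (Complex.I * (ω.toReal : ℂ)) f

/-- The frequency response matrix `G(jω)`, `ω ∈ [0, ∞]`. -/
def freqResp {m n : Type*} (G : Matrix m n TF) (ω : ℝ≥0∞) : Matrix m n ℂ :=
  G.map fun f => freqValue f ω

/-- The Gang of Four matrix `G # H`. -/
def gangOfFour {m : Type*} [Fintype m] [DecidableEq m] (G H : Matrix m m TF) :
    Matrix (m ⊕ m) (m ⊕ m) TF :=
  Matrix.fromBlocks (1 + H * G)⁻¹ ((1 + H * G)⁻¹ * H)
    (G * (1 + H * G)⁻¹) (G * (1 + H * G)⁻¹ * H)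

/-- Stability of the feedback interconnection of `G` and `H`: the loop is well posed
(`I + H G` is invertible, so that the Gang of Four exists) and `G # H` belongs to `RH∞`. -/
def IsStableFeedback {m : Type*} [Fintype m] [DecidableEq m] (G H : Matrix m m TF) : Prop :=
  IsUnit (1 + H * G).det ∧ IsRHInf (gangOfFour G H)

/-! ### Gains and phases of complex matrices -/

/-- The largest singular value of a matrix. -/
def maxGain {𝕜 : Type*} [RCLike 𝕜] {n : ℕ} (A : Matrix (Fin n) (Fin n) 𝕜) : ℝ :=
  (Matrix.toEuclideanLin A).singularValues 0

/-- The smallest singular value of an `n × n` matrix (the `n`-th one in decreasing order). -/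
def minGain {𝕜 : Type*} [RCLike 𝕜] {n : ℕ} (A : Matrix (Fin n) (Fin n) 𝕜) : ℝ :=
  (Matrix.toEuclideanLin A).singularValues (n - 1)

/-- The numerical range `W(A) = {x* A x : ‖x‖ = 1}`. -/
def numericalRange {n : Type*} [Fintype n] [DecidableEq n] (A : Matrix n n ℂ) : Set ℂ :=
  {w | ∃ x : EuclideanSpace ℂ n, ‖x‖ = 1 ∧ w = inner ℂ x (Matrix.toEuclideanLin A x)}

/-- `A` is sectorial if its numerical range does not contain `0`. -/
def IsSectorial {n : Type*} [Fintype n] [DecidableEq n] (A : Matrix n n ℂ) : Prop :=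
  (0 : ℂ) ∉ numericalRange A

/-- `φ` lists the phases of `A`: there is a decomposition `A = T* D T` with `T` nonsingular and
`D` diagonal unitary with eigenvalues `exp (i φ k)`, all the `φ k` lie within an interval of width
less than `π`, and the branch of the argument is the principal one, that is, the phase center
`(max φ + min φ) / 2` lies in `(-π, π]`. -/
def IsPhaseVector {n : Type*} [Fintype n] [DecidableEq n] (A : Matrix n n ℂ) (φ : n → ℝ) : Prop :=
  (∃ T : Matrix n n ℂ, IsUnit T.det ∧
      A = Tᴴ * Matrix.diagonal (fun k => Complex.exp (φ k * Complex.I)) * T) ∧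
    (∀ k l, φ k - φ l < Real.pi) ∧
    ((⨆ k, φ k) + (⨅ k, φ k)) / 2 ∈ Set.Ioc (-Real.pi) Real.pi

/-- The set of phases of `A`. -/
def phases {n : Type*} [Fintype n] [DecidableEq n] (A : Matrix n n ℂ) : Set ℝ :=
  {t | ∃ φ : n → ℝ, IsPhaseVector A φ ∧ ∃ k, φ k = t}

/-- The largest phase of a sectorial matrix. -/
def maxPhase {n : Type*} [Fintype n] [DecidableEq n] (A : Matrix n n ℂ) : ℝ := sSup (phases A)

/-- The smallest phase of a sectorial matrix. -/
def minPhase {n : Type*} [Fintype n] [DecidableEq n] (A : Matrix n n ℂ) : ℝ := sInf (phases A)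

/-! ### The power network -/

/-- The ungrounded nodes: `N` converter nodes and `K` interior nodes. -/
abbrev Node (N K : ℕ) : Type := Fin N ⊕ Fin K

/-- All nodes; `none` is the common grounded node. -/
abbrev GNode (N K : ℕ) : Type := Option (Node N K)

/-- A network of R-L lines. Each line has a resistance `R ≥ 0` and a reactance `X > 0`, and the
network (including the grounded node) is connected. -/
structure RLNetwork (N K : ℕ) where
  lines : SimpleGraph (GNode N K)
  R : GNode N K → GNode N K → ℝ
  X : GNode N K → GNode N K → ℝ
  R_symm : ∀ i j, R i j = R j i
  X_symm : ∀ i j, X i j = X j i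
  R_nonneg : ∀ i j, lines.Adj i j → 0 ≤ R i j
  X_pos : ∀ i j, lines.Adj i j → 0 < X i j
  connected : lines.Connected

/-- `F_ε(s)`, the inverse of `[[s/ω₀ + ε, -1], [1, s/ω₀ + ε]]`. -/
def lineF (ω₀ ε : ℝ) : Matrix (Fin 2) (Fin 2) TF :=
  (!![RatFunc.X / RatFunc.C ω₀ + RatFunc.C ε, -1;
      1, RatFunc.X / RatFunc.C ω₀ + RatFunc.C ε])⁻¹

/-- Grounded Laplacian with `m × m` blocks of a network with edge weights `w` (`none` is the
grounded node): the off-diagonal blocks are `-w i j`, the diagonal ones `∑ j, w i j`, where the sum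
includes the grounded node. -/
def blockLaplacian {V m R : Type*} [Fintype V] [DecidableEq V] [CommRing R]
    (w : Option V → Option V → Matrix m m R) : Matrix (V × m) (V × m) R :=
  Matrix.of fun p q =>
    if p.1 = q.1 then (∑ j : Option V, w (some p.1) j) p.2 q.2
    else (-w (some p.1) (some q.1)) p.2 q.2

/-- Grounded Laplacian with scalar edge weights. -/
def groundedLaplacian {V R : Type*} [Fintype V] [DecidableEq V] [CommRing R]
    (w : Option V → Option V → R) : Matrix V V R :=
  Matrix.of fun i j => if i = j then ∑ k : Option V, w (some i) k else -w (some i) (some j)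

/-- Kron reduction: elimination of the second block of variables (Schur complement). -/
def kronReduction {α β R : Type*} [Fintype β] [DecidableEq β] [CommRing R]
    (A : Matrix (α ⊕ β) (α ⊕ β) R) : Matrix α α R :=
  A.toBlocks₁₁ - A.toBlocks₁₂ * A.toBlocks₂₂⁻¹ * A.toBlocks₂₁

namespace RLNetwork

variable {N K : ℕ}

/-- Every line of the network has the R/X ratio `ε`. -/
def HasRXRatio (net : RLNetwork N K) (ε : ℝ) : Prop :=
  ∀ i j, net.lines.Adj i j → net.R i j / net.X i j = ε

open Classical in
/-- The susceptance `B i j = 1 / X i j` of the line between `i` and `j` (`0` if there is none). -/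
def susceptance (net : RLNetwork N K) (i j : GNode N K) : ℝ :=
  if net.lines.Adj i j then 1 / net.X i j else 0

/-- The admittance `B i j • F_{ε i j}(s)`, `ε i j = R i j / X i j`, of the line between `i` and `j`
(`0` if there is no line). -/
def lineAdmittance (net : RLNetwork N K) (ω₀ : ℝ) (i j : GNode N K) :
    Matrix (Fin 2) (Fin 2) TF :=
  RatFunc.C (net.susceptance i j) • lineF ω₀ (net.R i j / net.X i j)

/-- The network dynamics `Y_grid(s)` seen from the converter nodes: the Kron reduction of the
grounded Laplacian transfer function matrix of the network. -/
def gridAdmittance (net : RLNetwork N K) (ω₀ : ℝ) : Matrix (Fin N × Fin 2) (Fin N × Fin 2) TF :=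
  kronReduction ((blockLaplacian (net.lineAdmittance ω₀)).reindex
    (Equiv.sumProdDistrib (Fin N) (Fin K) (Fin 2)) (Equiv.sumProdDistrib (Fin N) (Fin K) (Fin 2)))

/-- The reduced susceptance Laplacian `B_r`. -/
def reducedLaplacian (net : RLNetwork N K) : Matrix (Fin N) (Fin N) ℝ :=
  kronReduction (groundedLaplacian net.susceptance)

/-- The eigenvalues of `S⁻¹ B_r`. -/
def gridEigenvalues (net : RLNetwork N K) (S : Fin N → ℝ) : Set ℝ :=
  {μ | Module.End.HasEigenvalue
    (Matrix.toLin' ((Matrix.diagonal S)⁻¹ * net.reducedLaplacian)) μ}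

/-- The generalized short-circuit ratio `gSCR = λ₁(S⁻¹ B_r)`, the smallest eigenvalue. -/
def gSCR (net : RLNetwork N K) (S : Fin N → ℝ) : ℝ := sInf (net.gridEigenvalues S)

end RLNetwork

/-- `S^(-1/2)` for the diagonal matrix `S` of capacity ratios. -/
def invSqrtDiag {N : ℕ} (S : Fin N → ℝ) : Matrix (Fin N) (Fin N) ℝ :=
  Matrix.diagonal fun i => (Real.sqrt (S i))⁻¹

/-! ### The multi-converter closed loop -/

/-- The rotation `exp (J θ)`. -/
def rot (θ : ℝ) : Matrix (Fin 2) (Fin 2) TF :=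
  (!![Real.cos θ, -Real.sin θ; Real.sin θ, Real.cos θ]).map RatFunc.C

/-- Block-diagonal matrix with blocks `M 1, …, M N`, indexed by (block, position in block). -/
def blockDiag {N : ℕ} (M : Fin N → Matrix (Fin 2) (Fin 2) TF) :
    Matrix (Fin N × Fin 2) (Fin N × Fin 2) TF :=
  (Matrix.blockDiagonal M).submatrix Prod.swap Prod.swap

/-- The rescaled dynamics `Y_{C,i}(s) F_ε(s)⁻¹` of a single converter. -/
def rescaledConverter (ω₀ ε : ℝ) (Y : Matrix (Fin 2) (Fin 2) TF) : Matrix (Fin 2) (Fin 2) TF :=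
  Y * (lineF ω₀ ε)⁻¹

/-- The converter side of the loop: `exp(Jϑ) Y_C^N(s) exp(-Jϑ) (I_N ⊗ F_ε(s)⁻¹)`. -/
def converterSide {N : ℕ} (ω₀ ε : ℝ) (θ : Fin N → ℝ) (YC : Fin N → Matrix (Fin 2) (Fin 2) TF) :
    Matrix (Fin N × Fin 2) (Fin N × Fin 2) TF :=
  blockDiag (fun i => rot (θ i)) * blockDiag YC * blockDiag (fun i => rot (-θ i)) *
    ((1 : Matrix (Fin N) (Fin N) TF) ⊗ₖ (lineF ω₀ ε)⁻¹)

/-- The rescaled network `(S^(-1/2) ⊗ I₂) Y_grid(s) (S^(-1/2) ⊗ F_ε(s)⁻¹)`. -/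
def rescaledGrid {N K : ℕ} (net : RLNetwork N K) (ω₀ ε : ℝ) (S : Fin N → ℝ) :
    Matrix (Fin N × Fin 2) (Fin N × Fin 2) TF :=
  ((invSqrtDiag S).map RatFunc.C ⊗ₖ (1 : Matrix (Fin 2) (Fin 2) TF)) * net.gridAdmittance ω₀ *
    ((invSqrtDiag S).map RatFunc.C ⊗ₖ (lineF ω₀ ε)⁻¹)

/-- The decentralized gain condition at the frequency `ω`. -/
def GainCondition {N K : ℕ} (net : RLNetwork N K) (ω₀ ε : ℝ) (S : Fin N → ℝ)
    (YC : Fin N → Matrix (Fin 2) (Fin 2) TF) (ω : ℝ≥0∞) : Prop :=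
  ∀ i, maxGain (freqResp (rescaledConverter ω₀ ε (YC i)) ω) < net.gSCR S

/-- The decentralized phase condition at the frequency `ω`; the phases of a matrix exist only if
it is sectorial. -/
def PhaseCondition {N : ℕ} (ω₀ ε : ℝ) (YC : Fin N → Matrix (Fin 2) (Fin 2) TF) (ω : ℝ≥0∞) : Prop :=
  (∀ i, IsSectorial (freqResp (rescaledConverter ω₀ ε (YC i)) ω)) ∧
  (∀ i, maxPhase (freqResp (rescaledConverter ω₀ ε (YC i)) ω) < Real.pi) ∧
  (∀ i, -Real.pi < minPhase (freqResp (rescaledConverter ω₀ ε (YC i)) ω)) ∧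
  (∀ i j, maxPhase (freqResp (rescaledConverter ω₀ ε (YC i)) ω) -
    minPhase (freqResp (rescaledConverter ω₀ ε (YC j)) ω) < Real.pi)

end PowerGrid

end

/-!
Rotations commute with `F_ε⁻¹`, so the converter side of the loop is
`G = diag(e^{Jθ_i} Ỹ_i e^{-Jθ_i})`, which is in `RH∞`. Since all lines share the factor `F_ε`, the
Kron reduction of the network is `B_r ⊗ F_ε` (`RLNetwork.gridAdmittance_eq`), and therefore
`H = P⁻¹ ⊗ I₂` is constant, with `P = S^(-1/2) B_r S^(-1/2)` (`rescaledGrid_inv_eq`). Connectedness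
of the grounded network makes `B_r`, and hence `P`, positive definite. As `P` is similar to
`S⁻¹ B_r`, its smallest eigenvalue, which is also its smallest singular value, is gSCR
(`exists_isLeast_spectrum`).

Stability follows from a homotopy. The loop is stable once `det (I + H G)` has no zero in the closed
right half-plane or at infinity. The Cayley transform turns this region into the closed unit disk,
on which `RH∞` functions are continuous, and holomorphic inside. If `det (I + τ H G)` has no zero on
the unit circle for all `τ ∈ [0, 1]`, its modulus has a positive lower bound `c` there, uniformly in
`τ`. By the maximum principle for the reciprocal, the absence of zeros in the disk means that the
modulus is at least `c` on the disk, so this property is both open and closed in `τ`, and it holds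
at `τ = 0` (`det_one_add_ne_zero_of_circle`, `isStableFeedback_of_det_ne_zero`).

On the imaginary axis, a kernel vector `x` of `I + τ H G` satisfies
`x* (P ⊗ I) x + τ x* G x = 0`, with `x* (P ⊗ I) x ≥ gSCR ‖x‖²`. Under the gain condition
`|x* G x| < gSCR ‖x‖²`. Under the phase condition, `x* G x` is a nonnegative combination of numbers
`e^{iφ}`, for `φ` running through the phases of the `Ỹ_i(jω)`; these lie in a half-plane without
negative real numbers (`exists_common_direction`). Both cases are contradictory
(`form_add_ne_zero`). The phase argument requires that a sectorial matrix has a decomposition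
`T* D T` at all: by the Toeplitz–Hausdorff theorem its numerical range is convex and compact, hence
strictly separated from `0`, so a rotation of the matrix has positive definite Hermitian part, and
the two Hermitian parts can be diagonalized simultaneously by congruence
(`IsSectorial.exists_decomposition`).
-/

noncomputable section

namespace PowerGrid

/-! ### Homogeneous evaluation of polynomials -/

open Polynomial in
/-- The value at `(a, b)` of the degree-`n` homogenization of `p`, that is,
`∑ k ≤ n, p_k a ^ k b ^ (n - k)`. -/
def homEval (p : ℝ[X]) (n : ℕ) (a b : ℂ) : ℂ :=
  MvPolynomial.aeval ![a, b] (p.homogenize n)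

section homEval
open Polynomial

variable {p q : ℝ[X]} {m n : ℕ} {a b : ℂ}

lemma homEval_eq_sum (p : ℝ[X]) (n : ℕ) (a b : ℂ) :
    homEval p n a b = ∑ kl ∈ Finset.HasAntidiagonal.antidiagonal n,
      (p.coeff kl.1 : ℂ) * (a ^ kl.1 * b ^ kl.2) := by
  unfold homEval homogenize
  simp [MvPolynomial.aeval_monomial, Finsupp.prod_fintype]

lemma homEval_mul (hp : p.natDegree ≤ m) (hq : q.natDegree ≤ n) (a b : ℂ) :
    homEval (p * q) (m + n) a b = homEval p m a b * homEval q n a b := by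
  simp [homEval, homogenize_mul p q hp hq]

lemma homEval_add (p q : ℝ[X]) (n : ℕ) (a b : ℂ) :
    homEval (p + q) n a b = homEval p n a b + homEval q n a b := by
  simp [homEval]

lemma homEval_eq_pow_mul_aeval (hp : p.natDegree ≤ n) (hb : b ≠ 0) :
    homEval p n a b = b ^ n * aeval (a / b) p := by
  rw [homEval_eq_sum, aeval_eq_sum_range' (Nat.lt_succ_of_le hp),
    Finset.Nat.sum_antidiagonal_eq_sum_range_succ_mk, Finset.mul_sum]
  refine Finset.sum_congr rfl fun k hk => ?_
  have hk' : k ≤ n := Nat.lt_succ_iff.mp (Finset.mem_range.mp hk)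
  rw [← Nat.sub_add_cancel hk', pow_add, Nat.add_sub_cancel, Complex.real_smul, div_pow]
  field_simp

lemma homEval_zero_right (p : ℝ[X]) (n : ℕ) (a : ℂ) : homEval p n a 0 = p.coeff n * a ^ n := by
  rw [homEval_eq_sum, Finset.sum_eq_single (n, 0)]
  · simp
  · rintro ⟨k, l⟩ h1 h2
    have : l ≠ 0 := by rintro rfl; simp_all
    simp [this]
  · simp

lemma homEval_conj (p : ℝ[X]) (n : ℕ) (a b : ℂ) :
    homEval p n (star a) (star b) = star (homEval p n a b) := by
  simp [homEval_eq_sum]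

end homEval

/-! ### Transfer functions on the closed unit disk -/

/-- A real polynomial is stable if all its complex roots lie in the open left half-plane. -/
def IsStablePoly (q : Polynomial ℝ) : Prop := ∀ z : ℂ, Polynomial.aeval z q = 0 → z.re < 0

/-- The value of `f` at `s = (1 - w) / (1 + w)`. The Cayley transform maps the closed unit disk to
the closed right half-plane with the point `∞`, which corresponds to `w = -1`; homogeneous
coordinates `s = (1 - w : 1 + w)` treat `∞` like any other point. -/
def diskValue (f : TF) (w : ℂ) : ℂ :=
  homEval f.num f.denom.natDegree (1 - w) (1 + w) /
    homEval f.denom f.denom.natDegree (1 - w) (1 + w)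

lemma re_cayley_nonneg {w : ℂ} (hw : ‖w‖ ≤ 1) : 0 ≤ ((1 - w) / (1 + w)).re := by
  rw [Complex.div_re, ← add_div]
  refine div_nonneg ?_ (Complex.normSq_nonneg _)
  have h : Complex.normSq w ≤ 1 := by
    rw [Complex.normSq_eq_norm_sq]; nlinarith [norm_nonneg w]
  rw [Complex.normSq_apply] at h
  simp only [Complex.sub_re, Complex.one_re, Complex.add_re, Complex.sub_im, Complex.one_im,
    Complex.add_im]
  nlinarith

lemma IsStablePoly.ne_zero {q : Polynomial ℝ} (hq : IsStablePoly q) : q ≠ 0 := by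
  rintro rfl
  simpa using hq 0

lemma IsStablePoly.homEval_ne_zero {q : Polynomial ℝ} (hq : IsStablePoly q) {w : ℂ}
    (hw : ‖w‖ ≤ 1) : homEval q q.natDegree (1 - w) (1 + w) ≠ 0 := by
  by_cases h : 1 + w = 0
  · have hw1 : 1 - w = 2 := by linear_combination -h
    rw [h, homEval_zero_right, hw1]
    simpa using hq.ne_zero
  · rw [homEval_eq_pow_mul_aeval le_rfl h]
    exact mul_ne_zero (pow_ne_zero _ h) fun h0 => (hq _ h0).not_ge (re_cayley_nonneg hw)

lemma IsStablePoly.mul {p q : Polynomial ℝ} (hp : IsStablePoly p) (hq : IsStablePoly q) :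
    IsStablePoly (p * q) := by
  intro z hz
  rw [map_mul, mul_eq_zero] at hz
  exact hz.elim (hp z) (hq z)

lemma num_mul_eq_mul_denom {p q : Polynomial ℝ} (hq : q ≠ 0) {f : TF}
    (hf : f = algebraMap _ TF p / algebraMap _ TF q) : f.num * q = p * f.denom :=
  (RatFunc.num_mul_eq_mul_denom_iff hq).2 hf

lemma denom_dvd_of_eq_div {p q : Polynomial ℝ} {f : TF}
    (hf : f = algebraMap _ TF p / algebraMap _ TF q) : f.denom ∣ q := by
  rw [hf]; exact RatFunc.denom_div_dvd p q

/-- `RH∞` membership may be read off from any fraction representing `f`. -/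
lemma isRHInfEntry_of_eq_div {p q : Polynomial ℝ} (hq : IsStablePoly q)
    (hpq : p.natDegree ≤ q.natDegree) {f : TF}
    (hf : f = algebraMap _ TF p / algebraMap _ TF q) : IsRHInfEntry f := by
  have hq0 := hq.ne_zero
  have h1 := num_mul_eq_mul_denom hq0 hf
  have h2 := denom_dvd_of_eq_div hf
  refine ⟨?_, fun z hz => ?_⟩
  · by_cases hp : p = 0
    · have : f = 0 := by rw [hf, hp]; simp
      simp [this]
    · have hn : f.num ≠ 0 := by
        rintro h
        rw [h, zero_mul] at h1
        exact mul_ne_zero hp f.denom_ne_zero h1.symm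
      have h3 := congrArg Polynomial.natDegree h1
      rw [Polynomial.natDegree_mul hn hq0, Polynomial.natDegree_mul hp f.denom_ne_zero] at h3
      omega
  · obtain ⟨c, hc⟩ := h2
    exact hq z (by rw [hc, map_mul, hz, zero_mul])

/-- Values on the disk may be computed from any fraction representing `f`. -/
lemma diskValue_eq_div {p q : Polynomial ℝ} (hq : IsStablePoly q)
    (hpq : p.natDegree ≤ q.natDegree) {f : TF}
    (hf : f = algebraMap _ TF p / algebraMap _ TF q) {w : ℂ} (hw : ‖w‖ ≤ 1) :
    diskValue f w = homEval p q.natDegree (1 - w) (1 + w) /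
      homEval q q.natDegree (1 - w) (1 + w) := by
  have hq0 := hq.ne_zero
  obtain ⟨hn, hd⟩ := isRHInfEntry_of_eq_div hq hpq hf
  rw [diskValue, div_eq_div_iff (IsStablePoly.homEval_ne_zero hd hw) (hq.homEval_ne_zero hw),
    ← homEval_mul hn le_rfl, ← homEval_mul hpq le_rfl, num_mul_eq_mul_denom hq0 hf, add_comm]

lemma eq_num_div_denom (f : TF) : f = algebraMap _ TF f.num / algebraMap _ TF f.denom :=
  (RatFunc.num_div_denom f).symm

lemma isRHInfEntry_C (r : ℝ) : IsRHInfEntry (RatFunc.C r) := by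
  constructor <;> simp

lemma diskValue_C (r : ℝ) (w : ℂ) : diskValue (RatFunc.C r) w = r := by
  simp [diskValue, homEval_eq_sum]

section ring

variable {f g : TF}

lemma add_eq_num_denom_div (f g : TF) :
    f + g = algebraMap _ TF (f.num * g.denom + g.num * f.denom) /
      algebraMap _ TF (f.denom * g.denom) := by
  have hf := RatFunc.algebraMap_ne_zero f.denom_ne_zero
  have hg := RatFunc.algebraMap_ne_zero g.denom_ne_zero
  conv_lhs => rw [eq_num_div_denom f, eq_num_div_denom g]
  simp only [map_add, map_mul]
  field_simp

lemma mul_eq_num_denom_div (f g : TF) :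
    f * g = algebraMap _ TF (f.num * g.num) / algebraMap _ TF (f.denom * g.denom) := by
  conv_lhs => rw [eq_num_div_denom f, eq_num_div_denom g]
  simp only [map_mul, div_mul_div_comm]

lemma natDegree_denom_mul (f g : TF) :
    (f.denom * g.denom).natDegree = f.denom.natDegree + g.denom.natDegree :=
  Polynomial.natDegree_mul f.denom_ne_zero g.denom_ne_zero

lemma IsRHInfEntry.natDegree_add_le (hf : IsRHInfEntry f) (hg : IsRHInfEntry g) :
    (f.num * g.denom + g.num * f.denom).natDegree ≤ (f.denom * g.denom).natDegree := by
  rw [natDegree_denom_mul]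
  refine Polynomial.natDegree_add_le_of_degree_le ?_ ?_
  · exact Polynomial.natDegree_mul_le.trans (by have := hf.1; omega)
  · exact Polynomial.natDegree_mul_le.trans (by have := hg.1; omega)

lemma IsRHInfEntry.natDegree_mul_le (hf : IsRHInfEntry f) (hg : IsRHInfEntry g) :
    (f.num * g.num).natDegree ≤ (f.denom * g.denom).natDegree := by
  rw [natDegree_denom_mul]
  exact Polynomial.natDegree_mul_le.trans (by have := hg.1; have := hf.1; omega)

lemma IsRHInfEntry.add (hf : IsRHInfEntry f) (hg : IsRHInfEntry g) : IsRHInfEntry (f + g) :=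
  isRHInfEntry_of_eq_div (IsStablePoly.mul hf.2 hg.2) (hf.natDegree_add_le hg)
    (add_eq_num_denom_div f g)

lemma IsRHInfEntry.mul (hf : IsRHInfEntry f) (hg : IsRHInfEntry g) : IsRHInfEntry (f * g) :=
  isRHInfEntry_of_eq_div (IsStablePoly.mul hf.2 hg.2) (hf.natDegree_mul_le hg)
    (mul_eq_num_denom_div f g)

lemma IsRHInfEntry.diskValue_add (hf : IsRHInfEntry f) (hg : IsRHInfEntry g) {w : ℂ}
    (hw : ‖w‖ ≤ 1) : diskValue (f + g) w = diskValue f w + diskValue g w := by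
  have hf0 := IsStablePoly.homEval_ne_zero hf.2 hw
  have hg0 := IsStablePoly.homEval_ne_zero hg.2 hw
  rw [diskValue_eq_div (IsStablePoly.mul hf.2 hg.2) (hf.natDegree_add_le hg)
      (add_eq_num_denom_div f g) hw,
    natDegree_denom_mul, homEval_add, homEval_mul hf.1 le_rfl, homEval_mul le_rfl le_rfl,
    add_comm f.denom.natDegree, homEval_mul hg.1 le_rfl, diskValue, diskValue]
  field_simp

lemma IsRHInfEntry.diskValue_mul (hf : IsRHInfEntry f) (hg : IsRHInfEntry g) {w : ℂ}
    (hw : ‖w‖ ≤ 1) : diskValue (f * g) w = diskValue f w * diskValue g w := by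
  rw [diskValue_eq_div (IsStablePoly.mul hf.2 hg.2) (hf.natDegree_mul_le hg)
      (mul_eq_num_denom_div f g) hw,
    natDegree_denom_mul, homEval_mul hf.1 hg.1, homEval_mul le_rfl le_rfl, diskValue, diskValue,
    div_mul_div_comm]

end ring

/-- The ring `RH∞` of scalar transfer functions. -/
def rhInf : Subring TF where
  carrier := {f | IsRHInfEntry f}
  mul_mem' := IsRHInfEntry.mul
  one_mem' := by simpa using isRHInfEntry_C 1
  add_mem' := IsRHInfEntry.add
  zero_mem' := by simpa using isRHInfEntry_C 0
  neg_mem' {f} hf := by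
    have := (isRHInfEntry_C (-1)).mul hf
    simpa using this

/-- Evaluation of `RH∞` functions at a point of the closed unit disk. -/
def diskEval (w : ℂ) (hw : ‖w‖ ≤ 1) : rhInf →+* ℂ where
  toFun f := diskValue f w
  map_one' := by simpa using diskValue_C 1 w
  map_mul' f g := f.2.diskValue_mul g.2 hw
  map_zero' := by simpa using diskValue_C 0 w
  map_add' f g := f.2.diskValue_add g.2 hw

@[simp] lemma diskEval_apply (w : ℂ) (hw : ‖w‖ ≤ 1) (f : rhInf) :
    diskEval w hw f = diskValue f w := rfl

lemma differentiableAt_homEval (p : Polynomial ℝ) (n : ℕ) (w : ℂ) :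
    DifferentiableAt ℂ (fun w => homEval p n (1 - w) (1 + w)) w := by
  simp only [homEval_eq_sum]
  fun_prop

lemma differentiableAt_diskValue {f : TF} (hf : IsRHInfEntry f) {w : ℂ} (hw : ‖w‖ ≤ 1) :
    DifferentiableAt ℂ (diskValue f) w :=
  (differentiableAt_homEval _ _ _).div (differentiableAt_homEval _ _ _)
    (IsStablePoly.homEval_ne_zero hf.2 hw)

/-- An `RH∞` function without zeros in the closed right half-plane and at `∞` is a unit of
`RH∞`. -/
lemma IsRHInfEntry.inv {f : TF} (hf : IsRHInfEntry f)
    (h : ∀ w : ℂ, ‖w‖ ≤ 1 → diskValue f w ≠ 0) : IsRHInfEntry f⁻¹ := by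
  have hinv : f⁻¹ = algebraMap _ TF f.denom / algebraMap _ TF f.num := by
    conv_lhs => rw [eq_num_div_denom f, inv_div]
  have hcoeff : f.num.coeff f.denom.natDegree ≠ 0 := by
    intro h0
    refine h (-1) (by simp) ?_
    rw [diskValue]
    simp [homEval_zero_right, h0]
  refine isRHInfEntry_of_eq_div (q := f.num) (fun z hz => ?_)
    (Polynomial.le_natDegree_of_ne_zero hcoeff) hinv
  by_contra! hre
  have hz1 : 1 + z ≠ 0 := by
    intro h0
    have := congrArg Complex.re h0
    simp at this
    linarith
  -- The inverse Cayley transform maps `z` back to the disk.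
  refine h ((1 - z) / (1 + z)) ?_ ?_
  · rw [norm_div, div_le_one (norm_pos_iff.2 hz1), ← sq_le_sq₀ (norm_nonneg _) (norm_nonneg _),
      ← Complex.normSq_eq_norm_sq, ← Complex.normSq_eq_norm_sq, Complex.normSq_apply,
      Complex.normSq_apply]
    simp only [Complex.sub_re, Complex.one_re, Complex.add_re, Complex.sub_im, Complex.one_im,
      Complex.add_im]
    nlinarith
  · have e1 : 1 + (1 - z) / (1 + z) = 2 / (1 + z) := by field_simp; ring
    have e2 : 1 - (1 - z) / (1 + z) = 2 * z / (1 + z) := by field_simp; ring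
    have e3 : 2 * z / (1 + z) / (2 / (1 + z)) = z := by field_simp
    rw [diskValue, e1, e2, homEval_eq_pow_mul_aeval hf.1 (div_ne_zero two_ne_zero hz1), e3, hz]
    simp

/-! ### The boundary of the disk -/

lemma diskValue_neg_one (f : TF) : diskValue f (-1) = freqValue f ⊤ := by
  have h2 : (2 : ℂ) ^ f.denom.natDegree ≠ 0 := pow_ne_zero _ two_ne_zero
  rw [diskValue]
  norm_num [homEval_zero_right, freqValue]
  rw [mul_div_mul_right _ _ h2]

lemma diskValue_eq_freqValue {f : TF} (hf : IsRHInfEntry f) {w : ℂ} (hw : 1 + w ≠ 0) {ω : ℝ}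
    (hω : 0 ≤ ω) (h : (1 - w) / (1 + w) = Complex.I * ω) :
    diskValue f w = freqValue f (ENNReal.ofReal ω) := by
  rw [diskValue, homEval_eq_pow_mul_aeval hf.1 hw, homEval_eq_pow_mul_aeval le_rfl hw, h,
    freqValue, if_neg ENNReal.ofReal_ne_top, ENNReal.toReal_ofReal hω, RatFunc.eval,
    mul_div_mul_left _ _ (pow_ne_zero _ hw)]
  rfl

lemma diskValue_conj (f : TF) (w : ℂ) : diskValue f (star w) = star (diskValue f w) := by
  have h1 : 1 - star w = star (1 - w) := by simp
  have h2 : 1 + star w = star (1 + w) := by simp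
  rw [diskValue, h1, h2, homEval_conj, homEval_conj, diskValue, star_div₀]

/-- On the unit circle the values of real rational functions are frequency responses (upper half of
the imaginary axis and `∞`) or conjugates of such (lower half). -/
lemma exists_freqValue_of_norm_eq_one {w : ℂ} (hw : ‖w‖ = 1) :
    ∃ ω : ℝ≥0∞, (∀ f : TF, IsRHInfEntry f → diskValue f w = freqValue f ω) ∨
      (∀ f : TF, IsRHInfEntry f → diskValue f w = star (freqValue f ω)) := by
  by_cases h : 1 + w = 0
  · obtain rfl : w = -1 := by linear_combination h
    exact ⟨⊤, Or.inl fun f _ => diskValue_neg_one f⟩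
  have hn : w.re * w.re + w.im * w.im = 1 := by
    rw [← Complex.normSq_apply, Complex.normSq_eq_norm_sq, hw, one_pow]
  have hre : ((1 - w) / (1 + w)).re = 0 := by
    rw [Complex.div_re, ← add_div]
    refine div_eq_zero_iff.2 (Or.inl ?_)
    simp only [Complex.sub_re, Complex.one_re, Complex.add_re, Complex.sub_im, Complex.one_im,
      Complex.add_im]
    linarith
  set ω := ((1 - w) / (1 + w)).im with hωdef
  have hω : (1 - w) / (1 + w) = Complex.I * ω := by
    apply Complex.ext <;> simp [hre, hωdef]
  rcases le_total 0 ω with h0 | h0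
  · exact ⟨_, Or.inl fun f hf => diskValue_eq_freqValue hf h h0 hω⟩
  · refine ⟨ENNReal.ofReal (-ω), Or.inr fun f hf => ?_⟩
    have hs : 1 + star w ≠ 0 := by
      intro h'
      apply h
      have := congrArg star h'
      simpa using this
    rw [← diskValue_eq_freqValue hf hs (neg_nonneg.2 h0), diskValue_conj, star_star]
    have := congrArg star hω
    simpa using this

/-! ### A homotopy argument for zeros in the disk -/

/-- If `det (1 + τ M(w))` does not vanish on the unit circle for all `τ ∈ [0, 1]`, then
`det (1 + M(w))` does not vanish on the disk. With `m > 0` a lower bound for the modulus on the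
circle, the set of `τ` for which the modulus is at least `m` on the whole disk is closed, contains
`0`, and is open by the maximum principle for the reciprocal. -/
lemma det_one_add_ne_zero_of_circle {m : Type*} [Fintype m] [DecidableEq m]
    (M : ℂ → Matrix m m ℂ)
    (hM : ∀ i j, ∀ w : ℂ, ‖w‖ ≤ 1 → DifferentiableAt ℂ (fun w => M w i j) w)
    (hb : ∀ w : ℂ, ‖w‖ = 1 → ∀ τ ∈ Set.Icc (0 : ℝ) 1, (1 + (τ : ℂ) • M w).det ≠ 0)
    {w : ℂ} (hw : ‖w‖ ≤ 1) : (1 + M w).det ≠ 0 := by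
  set f : ℝ → ℂ → ℂ := fun τ w => (1 + (τ : ℂ) • M w).det with hf
  have hdiff : ∀ τ : ℝ, ∀ w : ℂ, ‖w‖ ≤ 1 → DifferentiableAt ℂ (f τ) w := by
    intro τ w hw
    simp only [hf, Matrix.det_apply, Matrix.add_apply, Matrix.smul_apply]
    have := fun i j => hM i j w hw
    fun_prop (disch := assumption)
  have hcont : ∀ τ : ℝ, ∀ w : ℂ, ‖w‖ ≤ 1 → ContinuousAt (fun p : ℝ × ℂ => f p.1 p.2) (τ, w) := by
    intro τ w hw
    have h : ContinuousAt (fun p : ℝ × ℂ => M p.2) (τ, w) := by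
      refine ContinuousAt.comp (g := M) (f := Prod.snd) ?_ continuousAt_snd
      exact continuousAt_pi.2 fun i => continuousAt_pi.2 fun j => (hM i j w hw).continuousAt
    have h1 : ContinuousAt (fun p : ℝ × ℂ => 1 + (p.1 : ℂ) • M p.2) (τ, w) :=
      continuousAt_const.add
        ((Complex.continuous_ofReal.continuousAt.comp continuousAt_fst).smul h)
    exact (Continuous.matrix_det continuous_id).continuousAt.comp h1
  obtain ⟨c, hc0, hc⟩ : ∃ c : ℝ, 0 < c ∧ ∀ τ ∈ Set.Icc (0 : ℝ) 1, ∀ w : ℂ, ‖w‖ = 1 →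
      c ≤ ‖f τ w‖ := by
    have hK : IsCompact (Set.Icc (0 : ℝ) 1 ×ˢ Metric.sphere (0 : ℂ) 1) :=
      isCompact_Icc.prod (isCompact_sphere _ _)
    have hne : (Set.Icc (0 : ℝ) 1 ×ˢ Metric.sphere (0 : ℂ) 1).Nonempty :=
      ⟨(0, 1), by simp⟩
    obtain ⟨p, hp, hmin⟩ := hK.exists_isMinOn (f := fun p : ℝ × ℂ => ‖f p.1 p.2‖) hne
      (fun p hp => ((hcont p.1 p.2 (by simpa using hp.2.le)).norm).continuousWithinAt)
    refine ⟨_, norm_pos_iff.2 (hb p.2 (by simpa using hp.2) p.1 hp.1), fun τ hτ w hw => ?_⟩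
    exact hmin (show (τ, w) ∈ _ from ⟨hτ, by simpa using hw⟩)
  -- The maximum principle for `1 / f τ`.
  have hmax : ∀ τ ∈ Set.Icc (0 : ℝ) 1, (∀ w : ℂ, ‖w‖ ≤ 1 → f τ w ≠ 0) →
      ∀ w : ℂ, ‖w‖ ≤ 1 → c ≤ ‖f τ w‖ := by
    intro τ hτ hne w hw
    have hd : DiffContOnCl ℂ (fun w => (f τ w)⁻¹) (Metric.ball 0 1) := by
      refine DifferentiableOn.diffContOnCl fun z hz => ?_
      rw [closure_ball _ one_ne_zero, mem_closedBall_zero_iff] at hz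
      exact ((hdiff τ z hz).inv (hne z hz)).differentiableWithinAt
    have := Complex.norm_le_of_forall_mem_frontier_norm_le Metric.isBounded_ball hd (C := c⁻¹)
      (fun z hz => by
        rw [frontier_ball _ one_ne_zero, mem_sphere_zero_iff_norm] at hz
        rw [norm_inv]
        exact inv_anti₀ hc0 (hc τ hτ z hz))
      (z := w) (by rwa [closure_ball _ one_ne_zero, mem_closedBall_zero_iff])
    rw [norm_inv] at this
    exact (inv_le_inv₀ (norm_pos_iff.2 (hne w hw)) hc0).1 this
  set T : Set ℝ := {τ | ∀ w : ℂ, ‖w‖ ≤ 1 → c ≤ ‖f τ w‖} with hT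
  have hTclosed : IsClosed T := by
    simp only [hT, Set.ofPred_forall]
    refine isClosed_iInter fun w => isClosed_iInter fun _ => ?_
    refine isClosed_le continuous_const (Continuous.norm ?_)
    exact Continuous.matrix_det (by fun_prop)
  have hsub : Set.Icc (0 : ℝ) 1 ⊆ T := by
    refine (hTclosed.inter isClosed_Icc).Icc_subset_of_forall_mem_nhdsWithin ?_ ?_
    · exact hmax 0 (by simp) fun w _ => by simp [hf]
    · rintro τ ⟨hτ, hτ01⟩
      have hev : ∀ᶠ σ in nhds τ, ∀ w ∈ Metric.closedBall (0 : ℂ) 1, f σ w ≠ 0 := by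
        refine (isCompact_closedBall _ _).eventually_forall_of_forall_eventually fun w hw => ?_
        rw [mem_closedBall_zero_iff] at hw
        exact (hcont τ w hw).eventually_ne (norm_pos_iff.1 (hc0.trans_le (hτ w hw)))
      have hIcc : Set.Icc (0 : ℝ) 1 ∈ nhdsWithin τ (Set.Ioi τ) :=
        Icc_mem_nhdsGT_of_mem hτ01
      filter_upwards [hIcc, mem_nhdsWithin_of_mem_nhds hev] with σ hσ hσ'
      exact hmax σ hσ fun w hw => hσ' w (mem_closedBall_zero_iff.2 hw)
  have := hsub (show (1 : ℝ) ∈ Set.Icc (0 : ℝ) 1 by simp) w hw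
  rw [← norm_pos_iff]
  simpa [hf] using hc0.trans_le this

/-! ### Stability from nonsingularity on the imaginary axis -/

/-- A matrix with entries in `RH∞`, as a matrix over the ring `rhInf`. -/
def liftRH {m n : Type*} (G : Matrix m n TF) (hG : IsRHInf G) : Matrix m n rhInf :=
  Matrix.of fun i j => ⟨G i j, hG i j⟩

lemma isRHInf_map {m n : Type*} (G : Matrix m n rhInf) : IsRHInf (G.map rhInf.subtype) :=
  fun i j => (G i j).2

lemma IsRHInf.mul {m n p : Type*} [Fintype n] {G : Matrix m n TF} {H : Matrix n p TF}
    (hG : IsRHInf G) (hH : IsRHInf H) : IsRHInf (G * H) := fun i j =>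
  rhInf.sum_mem fun k _ => rhInf.mul_mem (hG i k) (hH k j)

/-- The values of a matrix of transfer functions on the closed unit disk. -/
def diskMatrix {m n : Type*} (G : Matrix m n TF) (w : ℂ) : Matrix m n ℂ :=
  G.map fun f => diskValue f w

section
variable {m : Type*} [Fintype m] [DecidableEq m]

lemma diskValue_det_one_add_mul {G H : Matrix m m TF} (hG : IsRHInf G) (hH : IsRHInf H) :
    IsRHInfEntry (1 + H * G).det ∧ ∀ w : ℂ, ‖w‖ ≤ 1 →
      diskValue (1 + H * G).det w = (1 + diskMatrix H w * diskMatrix G w).det := by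
  have h : (1 + H * G).det = rhInf.subtype (1 + liftRH H hH * liftRH G hG).det := by
    rw [RingHom.map_det, map_add, map_one, map_mul]
    rfl
  refine ⟨by rw [h]; exact ((1 + liftRH H hH * liftRH G hG).det).2, fun w hw => ?_⟩
  have h2 := RingHom.map_det (diskEval w hw) (1 + liftRH H hH * liftRH G hG)
  rw [map_add, map_one, map_mul] at h2
  rw [h]
  exact h2

/-- Multivariable stability test: for stable `G` and `H`, the loop is stable if `I + τ H G` is
nonsingular on the imaginary axis and at `∞` for all `τ ∈ [0, 1]`. -/
lemma isStableFeedback_of_det_ne_zero {G H : Matrix m m TF} (hG : IsRHInf G) (hH : IsRHInf H)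
    (h : ∀ ω : ℝ≥0∞, ∀ τ ∈ Set.Icc (0 : ℝ) 1,
      (1 + (τ : ℂ) • (freqResp H ω * freqResp G ω)).det ≠ 0) : IsStableFeedback G H := by
  obtain ⟨hd, hdv⟩ := diskValue_det_one_add_mul hG hH
  have hcircle : ∀ w : ℂ, ‖w‖ = 1 → ∀ τ ∈ Set.Icc (0 : ℝ) 1,
      (1 + (τ : ℂ) • (diskMatrix H w * diskMatrix G w)).det ≠ 0 := by
    intro w hw τ hτ
    obtain ⟨ω, hω | hω⟩ := exists_freqValue_of_norm_eq_one hw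
    · have e : ∀ {F : Matrix m m TF}, IsRHInf F → diskMatrix F w = freqResp F ω := fun hF => by
        ext i j; exact hω _ (hF i j)
      rw [e hG, e hH]
      exact h ω τ hτ
    · have e : ∀ {F : Matrix m m TF}, IsRHInf F →
          diskMatrix F w = (starRingEnd ℂ).mapMatrix (freqResp F ω) := fun hF => by
        ext i j; exact hω _ (hF i j)
      have e2 : 1 + (τ : ℂ) • ((starRingEnd ℂ).mapMatrix (freqResp H ω) *
          (starRingEnd ℂ).mapMatrix (freqResp G ω)) =
          (starRingEnd ℂ).mapMatrix (1 + (τ : ℂ) • (freqResp H ω * freqResp G ω)) := by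
        rw [← map_mul]
        generalize freqResp H ω * freqResp G ω = Q
        rw [map_add, map_one]
        ext i j
        simp
      rw [e hG, e hH, e2, ← RingHom.map_det]
      exact (map_ne_zero _).2 (h ω τ hτ)
  have hdisk : ∀ w : ℂ, ‖w‖ ≤ 1 → diskValue (1 + H * G).det w ≠ 0 := by
    intro w hw
    rw [hdv w hw]
    refine det_one_add_ne_zero_of_circle (fun w => diskMatrix H w * diskMatrix G w)
      (fun i j w hw => ?_) hcircle hw
    simp only [Matrix.mul_apply]
    refine DifferentiableAt.fun_sum fun k _ => ?_
    exact (differentiableAt_diskValue (hH i k) hw).mul (differentiableAt_diskValue (hG k j) hw)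
  have hinv : IsRHInfEntry ((1 + H * G).det)⁻¹ := hd.inv hdisk
  have hne : (1 + H * G).det ≠ 0 := by
    intro h0
    refine hdisk 0 (by simp) ?_
    rw [h0]
    simpa using diskValue_C 0 0
  have hadj : IsRHInf (1 + H * G)⁻¹ := by
    intro i j
    rw [Matrix.inv_def, Ring.inverse_eq_inv', Matrix.smul_apply, smul_eq_mul]
    refine hinv.mul ?_
    have e : (1 + H * G).adjugate = (1 + liftRH H hH * liftRH G hG).adjugate.map rhInf.subtype := by
      have := RingHom.map_adjugate rhInf.subtype (1 + liftRH H hH * liftRH G hG)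
      rw [map_add, map_one, map_mul] at this
      exact this.symm
    rw [e]
    exact isRHInf_map _ i j
  refine ⟨isUnit_iff_ne_zero.2 hne, ?_⟩
  rintro (i | i) (j | j)
  · exact hadj i j
  · exact hadj.mul hH i j
  · exact hG.mul hadj i j
  · exact (hG.mul hadj).mul hH i j

end

/-! ### The numerical range is convex -/

section numericalRange
variable {n : Type*} [Fintype n]

lemma norm_sq_eq_star_dotProduct (x : EuclideanSpace ℂ n) :
    ((‖x‖ ^ 2 : ℝ) : ℂ) = star x.ofLp ⬝ᵥ x.ofLp := by
  rw [dotProduct_comm, ← EuclideanSpace.inner_eq_star_dotProduct, inner_self_eq_norm_sq_to_K]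
  simp

lemma star_smul_dotProduct_mulVec_smul (A : Matrix n n ℂ) (c : ℂ) (x : n → ℂ) :
    star (c • x) ⬝ᵥ A *ᵥ (c • x) = ((‖c‖ ^ 2 : ℝ) : ℂ) * (star x ⬝ᵥ A *ᵥ x) := by
  rw [star_smul, smul_dotProduct, Matrix.mulVec_smul, dotProduct_smul, smul_eq_mul, smul_eq_mul,
    ← mul_assoc, Complex.star_def, Complex.conj_mul']
  simp

/-- Some unit `c` makes `c a + c̄ b` a real multiple of `p`. -/
lemma exists_unit_cross_real (a b : ℂ) {p : ℂ} (hp : p ≠ 0) :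
    ∃ c : ℂ, ‖c‖ = 1 ∧ ∃ r : ℝ, c * a + star c * b = r * p := by
  set d := a / p - star (b / p) with hd
  obtain ⟨c, hc, hcd⟩ : ∃ c : ℂ, ‖c‖ = 1 ∧ (c * d).im = 0 := by
    by_cases h : d = 0
    · exact ⟨1, by simp, by simp [h]⟩
    · refine ⟨star d / ‖d‖, ?_, ?_⟩
      · simp [h]
      · rw [div_mul_eq_mul_div, Complex.star_def, Complex.conj_mul', ← Complex.ofReal_pow,
          ← Complex.ofReal_div, Complex.ofReal_im]
  refine ⟨c, hc, (c * (a / p) + star c * (b / p)).re, ?_⟩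
  have him : (c * (a / p) + star c * (b / p)).im = 0 := by
    rw [hd] at hcd
    simp only [Complex.mul_im, Complex.add_im, Complex.sub_re, Complex.sub_im, Complex.star_def,
      Complex.conj_re, Complex.conj_im] at hcd ⊢
    linarith
  have hre : (((c * (a / p) + star c * (b / p)).re : ℝ) : ℂ) = c * (a / p) + star c * (b / p) := by
    apply Complex.ext
    · simp
    · rw [Complex.ofReal_im, him]
  rw [hre]
  field_simp

/-- Two vectors with opposite nonzero values of the quadratic form span a nonzero vector on which
the form vanishes. -/
lemma exists_dotProduct_mulVec_eq_zero (A : Matrix n n ℂ) {x y : n → ℂ} {p : ℂ} (hp : p ≠ 0)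
    (hx : star x ⬝ᵥ A *ᵥ x = p) (hy : star y ⬝ᵥ A *ᵥ y = -p) :
    ∃ v : n → ℂ, v ≠ 0 ∧ star v ⬝ᵥ A *ᵥ v = 0 := by
  obtain ⟨c, hc, r, hr⟩ := exists_unit_cross_real (star x ⬝ᵥ A *ᵥ y) (star y ⬝ᵥ A *ᵥ x) hp
  -- `t` is the positive root of `t ^ 2 + r t - 1`.
  obtain ⟨t, ht0, ht⟩ : ∃ t : ℝ, 0 < t ∧ t ^ 2 + r * t - 1 = 0 := by
    have hs := Real.sq_sqrt (show (0 : ℝ) ≤ r ^ 2 + 4 by positivity)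
    have hs0 := Real.sqrt_nonneg (r ^ 2 + 4)
    refine ⟨(-r + √(r ^ 2 + 4)) / 2, ?_, by nlinarith⟩
    have : r < √(r ^ 2 + 4) := Real.lt_sqrt_of_sq_lt (by linarith)
    linarith
  have htc : (t : ℂ) ^ 2 + r * t - 1 = 0 := by exact_mod_cast ht
  have htc0 : (t : ℂ) ≠ 0 := by exact_mod_cast ht0.ne'
  have hcc : star c * c = 1 := by rw [Complex.star_def, Complex.conj_mul', hc]; simp
  refine ⟨(t : ℂ) • x + c • y, fun h0 => ?_, ?_⟩
  · have hxy : x = (-(c / t)) • y := by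
      have : (t : ℂ) • x = -(c • y) := eq_neg_of_add_eq_zero_left h0
      rw [neg_smul, div_eq_inv_mul, mul_smul, ← smul_neg, ← this, smul_smul,
        inv_mul_cancel₀ htc0, one_smul]
    have h1 := star_smul_dotProduct_mulVec_smul A (-(c / t)) y
    rw [← hxy, hx, hy] at h1
    have h2 : (((‖-(c / t)‖ ^ 2 : ℝ) : ℂ) + 1) * p = 0 := by linear_combination h1
    rcases mul_eq_zero.1 h2 with h3 | h3
    · have h4 : ‖-(c / (t : ℂ))‖ ^ 2 + 1 = 0 := by exact_mod_cast h3
      nlinarith [sq_nonneg ‖-(c / (t : ℂ))‖]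
    · exact hp h3
  · simp only [star_add, star_smul, add_dotProduct, smul_dotProduct, Matrix.mulVec_add,
      Matrix.mulVec_smul, dotProduct_add, dotProduct_smul, smul_eq_mul, hx, hy]
    rw [show star (t : ℂ) = (t : ℂ) from Complex.conj_ofReal t]
    linear_combination (t : ℂ) * hr + p * htc - p * hcc

variable [DecidableEq n]

lemma inner_toEuclideanLin (A : Matrix n n ℂ) (x : EuclideanSpace ℂ n) :
    inner ℂ x (Matrix.toEuclideanLin A x) = star x.ofLp ⬝ᵥ A *ᵥ x.ofLp := by
  rw [EuclideanSpace.inner_eq_star_dotProduct, dotProduct_comm]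
  rfl

/-- The numerical range consists of the Rayleigh quotients of nonzero vectors. -/
lemma mem_numericalRange_of_dotProduct_eq {A : Matrix n n ℂ} {z : ℂ} {v : n → ℂ} (hv : v ≠ 0)
    (h : star v ⬝ᵥ A *ᵥ v = z * (star v ⬝ᵥ v)) : z ∈ numericalRange A := by
  set x : EuclideanSpace ℂ n := WithLp.toLp 2 v with hx
  have hx0 : ‖x‖ ≠ 0 := by
    rw [norm_ne_zero_iff]
    intro h0
    exact hv (by simpa [hx] using h0)
  have hxc : (‖x‖ : ℂ) ≠ 0 := by exact_mod_cast hx0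
  refine ⟨((‖x‖⁻¹ : ℝ) : ℂ) • x, ?_, ?_⟩
  · rw [norm_smul, Complex.norm_real, norm_inv, norm_norm, inv_mul_cancel₀ hx0]
  · rw [inner_toEuclideanLin, WithLp.ofLp_smul, star_smul_dotProduct_mulVec_smul,
      show x.ofLp = v from rfl, h, show star v ⬝ᵥ v = ((‖x‖ ^ 2 : ℝ) : ℂ) from
        (norm_sq_eq_star_dotProduct x).symm]
    rw [Complex.norm_real, norm_inv, norm_norm]
    push_cast
    field_simp

/-- The **Toeplitz–Hausdorff theorem**. -/
lemma convex_numericalRange (A : Matrix n n ℂ) : Convex ℝ (numericalRange A) := by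
  rintro p ⟨x, hx, rfl⟩ q ⟨y, hy, rfl⟩ a b ha hb hab
  rw [inner_toEuclideanLin, inner_toEuclideanLin]
  set p := star x.ofLp ⬝ᵥ A *ᵥ x.ofLp with hp
  set q := star y.ofLp ⬝ᵥ A *ᵥ y.ofLp with hq
  have hx1 : star x.ofLp ⬝ᵥ x.ofLp = 1 := by rw [← norm_sq_eq_star_dotProduct, hx]; simp
  have hy1 : star y.ofLp ⬝ᵥ y.ofLp = 1 := by rw [← norm_sq_eq_star_dotProduct, hy]; simp
  have hpm : p ∈ numericalRange A := ⟨x, hx, (inner_toEuclideanLin A x).symm⟩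
  have hqm : q ∈ numericalRange A := ⟨y, hy, (inner_toEuclideanLin A y).symm⟩
  have habc : (a : ℂ) + b = 1 := by exact_mod_cast hab
  simp only [Complex.real_smul]
  set z := (a : ℂ) * p + b * q with hz
  by_cases hdeg : (a : ℂ) * b * (p - q) = 0
  · rcases mul_eq_zero.1 hdeg with h | h
    · rcases mul_eq_zero.1 h with h | h
      · have : z = q := by rw [hz]; linear_combination q * habc + (p - q) * h
        rwa [this]
      · have : z = p := by rw [hz]; linear_combination p * habc + (q - p) * h
        rwa [this]
    · have : z = p := by rw [hz]; linear_combination p * habc - b * h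
      rwa [this]
  -- Apply the previous lemma to the form shifted by `z`.
  have hshift : ∀ v : n → ℂ, star v ⬝ᵥ (A - z • 1) *ᵥ v
      = star v ⬝ᵥ A *ᵥ v - z * (star v ⬝ᵥ v) := by
    intro v
    rw [Matrix.sub_mulVec, dotProduct_sub, Matrix.smul_mulVec, Matrix.one_mulVec, dotProduct_smul,
      smul_eq_mul]
  have hsq : ∀ {c : ℝ}, 0 ≤ c → ((‖((√c : ℝ) : ℂ)‖ ^ 2 : ℝ) : ℂ) = c := by
    intro c hc
    rw [Complex.norm_real, Real.norm_eq_abs, sq_abs, Real.sq_sqrt hc]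
  obtain ⟨v, hv, hv0⟩ := exists_dotProduct_mulVec_eq_zero (A - z • 1) (p := a * b * (p - q)) hdeg
    (x := ((√a : ℝ) : ℂ) • x.ofLp) (y := ((√b : ℝ) : ℂ) • y.ofLp)
    (by rw [star_smul_dotProduct_mulVec_smul, hshift, hsq ha, hx1, ← hp, hz]
        linear_combination (-(a : ℂ) * p) * habc)
    (by rw [star_smul_dotProduct_mulVec_smul, hshift, hsq hb, hy1, ← hq, hz]
        linear_combination (-(b : ℂ) * q) * habc)
  refine mem_numericalRange_of_dotProduct_eq hv ?_
  rw [hshift] at hv0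
  linear_combination hv0

lemma isCompact_numericalRange (A : Matrix n n ℂ) : IsCompact (numericalRange A) := by
  have : numericalRange A = (fun x : EuclideanSpace ℂ n => inner ℂ x (Matrix.toEuclideanLin A x)) ''
      Metric.sphere 0 1 := by
    ext w
    simp [numericalRange, eq_comm]
  rw [this]
  refine (isCompact_sphere _ _).image (Continuous.inner continuous_id ?_)
  exact LinearMap.continuous_of_finiteDimensional _

/-- A sectorial matrix has, up to a rotation, a positive definite Hermitian part. -/
lemma IsSectorial.exists_re_pos [Nonempty n] {A : Matrix n n ℂ} (hA : IsSectorial A) :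
    ∃ δ : ℝ, ∀ x : n → ℂ, x ≠ 0 →
      0 < (Complex.exp (-(δ * Complex.I)) * (star x ⬝ᵥ A *ᵥ x)).re := by
  obtain ⟨f, u, hu0, hu⟩ := geometric_hahn_banach_point_closed (convex_numericalRange A)
    (isCompact_numericalRange A).isClosed hA
  rw [map_zero] at hu0
  set g : ℂ := ⟨f 1, f Complex.I⟩ with hg
  have hf : ∀ b : ℂ, f b = (star g * b).re := by
    intro b
    conv_lhs => rw [← Complex.re_add_im b]
    have h1 : ((b.re : ℂ) + b.im * Complex.I) = b.re • (1 : ℂ) + b.im • Complex.I := by simp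
    rw [h1, map_add, map_smul, map_smul]
    simp [hg, mul_comm]
  refine ⟨g.arg, fun x hx => ?_⟩
  have hxx : star x ⬝ᵥ x = ((‖(WithLp.toLp 2 x : EuclideanSpace ℂ n)‖ ^ 2 : ℝ) : ℂ) :=
    (norm_sq_eq_star_dotProduct _).symm
  have hN : 0 < ‖(WithLp.toLp 2 x : EuclideanSpace ℂ n)‖ ^ 2 := by
    have : (WithLp.toLp 2 x : EuclideanSpace ℂ n) ≠ 0 := by simpa using hx
    positivity
  set N := ‖(WithLp.toLp 2 x : EuclideanSpace ℂ n)‖ ^ 2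
  have hNc : (N : ℂ) ≠ 0 := by exact_mod_cast hN.ne'
  have hmem : (star x ⬝ᵥ A *ᵥ x) / N ∈ numericalRange A :=
    mem_numericalRange_of_dotProduct_eq hx (by rw [hxx]; field_simp)
  have hpos : 0 < (star g * ((star x ⬝ᵥ A *ᵥ x) / N)).re := by
    rw [← hf]; exact hu0.trans (hu _ hmem)
  have hg' : star g = ‖g‖ * Complex.exp (-(g.arg * Complex.I)) := by
    conv_lhs => rw [← Complex.norm_mul_exp_arg_mul_I g]
    rw [Complex.star_def, map_mul, Complex.conj_ofReal, ← Complex.exp_conj, map_mul,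
      Complex.conj_ofReal, Complex.conj_I, mul_neg]
  rw [hg', mul_assoc, Complex.re_ofReal_mul, mul_div_assoc', Complex.div_ofReal_re] at hpos
  have h2 := pos_of_mul_pos_right hpos (norm_nonneg _)
  exact (div_pos_iff_of_pos_right hN).1 h2

end numericalRange

/-! ### Phases of sectorial matrices -/

section phases
variable {n : Type*} [Fintype n] [DecidableEq n]

open scoped MatrixOrder ComplexOrder in
/-- A positive definite matrix has the form `R* R` with `R` nonsingular. -/
lemma exists_conjTranspose_mul_self {A : Matrix n n ℂ} (hA : A.PosDef) :
    ∃ R : Matrix n n ℂ, IsUnit R.det ∧ A = Rᴴ * R := by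
  obtain ⟨R, hR⟩ := CStarAlgebra.nonneg_iff_eq_star_mul_self.1
    (Matrix.nonneg_iff_posSemidef.2 hA.posSemidef)
  refine ⟨R, ?_, hR⟩
  have h := hA.det_pos.ne'
  rw [hR, Matrix.det_mul] at h
  exact isUnit_iff_ne_zero.2 (right_ne_zero_of_mul h)

lemma one_add_mul_I_eq (t : ℝ) :
    1 + (t : ℂ) * Complex.I = √(1 + t ^ 2) * Complex.exp (Real.arctan t * Complex.I) := by
  have h : (0 : ℝ) < 1 + t ^ 2 := by positivity
  have h' := (Real.sqrt_pos.2 h).ne'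
  rw [Complex.exp_mul_I, ← Complex.ofReal_cos, ← Complex.ofReal_sin, Real.cos_arctan,
    Real.sin_arctan]
  apply Complex.ext
  · simp [h']
  · simp
    field_simp

open scoped ComplexOrder in
/-- Simultaneous diagonalization by congruence of the Hermitian parts of a rotated sectorial
matrix. -/
lemma IsSectorial.exists_decomposition [Nonempty n] {A : Matrix n n ℂ} (hA : IsSectorial A) :
    ∃ (δ : ℝ) (μ : n → ℝ) (T : Matrix n n ℂ), IsUnit T.det ∧
      A = Tᴴ * Matrix.diagonal
        (fun k => Complex.exp ((δ + Real.arctan (μ k) : ℝ) * Complex.I)) * T := by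
  obtain ⟨δ, hδ⟩ := hA.exists_re_pos
  set e := Complex.exp (-(δ * Complex.I)) with he
  set B := e • A with hB
  set H := (2⁻¹ : ℂ) • (B + Bᴴ) with hH
  set K := (2⁻¹ * -Complex.I : ℂ) • (B - Bᴴ) with hK
  have hBHK : B = H + Complex.I • K := by
    rw [hH, hK, smul_smul, show Complex.I * (2⁻¹ * -Complex.I) = (2⁻¹ : ℂ) by
      linear_combination (-2⁻¹ : ℂ) * Complex.I_mul_I]
    ext i j
    simp
    ring
  have hHherm : H.IsHermitian := by
    rw [Matrix.IsHermitian, hH, Matrix.conjTranspose_smul, Matrix.conjTranspose_add,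
      Matrix.conjTranspose_conjTranspose, add_comm]
    simp
  have hKherm : K.IsHermitian := by
    rw [Matrix.IsHermitian, hK, Matrix.conjTranspose_smul, Matrix.conjTranspose_sub,
      Matrix.conjTranspose_conjTranspose, ← neg_sub, smul_neg, ← neg_smul]
    simp
  have hHpos : H.PosDef := by
    refine Matrix.PosDef.of_dotProduct_mulVec_pos hHherm fun x hx => ?_
    have h1 := hδ x hx
    have h2 : star x ⬝ᵥ Bᴴ *ᵥ x = star (star x ⬝ᵥ B *ᵥ x) := by
      rw [← Matrix.star_dotProduct, Matrix.star_mulVec, Matrix.dotProduct_mulVec]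
    have h3 : star x ⬝ᵥ H *ᵥ x = (((star x ⬝ᵥ B *ᵥ x).re : ℝ) : ℂ) := by
      rw [hH, Matrix.smul_mulVec, Matrix.add_mulVec, dotProduct_smul, dotProduct_add, h2,
        Complex.star_def, Complex.add_conj, smul_eq_mul]
      push_cast
      ring
    rw [h3]
    have h4 : star x ⬝ᵥ B *ᵥ x = e * (star x ⬝ᵥ A *ᵥ x) := by
      rw [hB, Matrix.smul_mulVec, dotProduct_smul, smul_eq_mul]
    rw [h4]
    exact_mod_cast h1
  obtain ⟨R, hR, hHR⟩ := exists_conjTranspose_mul_self hHpos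
  have hRR : R * R⁻¹ = 1 := Matrix.mul_nonsing_inv R hR
  have hRR' : R⁻¹ * R = 1 := Matrix.nonsing_inv_mul R hR
  set K' := (R⁻¹)ᴴ * K * R⁻¹ with hK'
  have hK'herm : K'.IsHermitian := Matrix.isHermitian_conjTranspose_mul_mul _ hKherm
  have hKK' : K = Rᴴ * K' * R := by
    rw [hK', ← Matrix.mul_assoc, ← Matrix.mul_assoc, ← Matrix.conjTranspose_mul, hRR',
      Matrix.conjTranspose_one, Matrix.one_mul, Matrix.mul_assoc, hRR', Matrix.mul_one]
  set μ := hK'herm.eigenvalues with hμ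
  set U : Matrix n n ℂ := (hK'herm.eigenvectorUnitary : Matrix n n ℂ) with hU
  have hUU : U * Uᴴ = 1 := Unitary.coe_mul_star_self hK'herm.eigenvectorUnitary
  have hspec : K' = U * Matrix.diagonal (fun k => (μ k : ℂ)) * Uᴴ := hK'herm.spectral_theorem
  set s : n → ℝ := fun k => √(√(1 + μ k ^ 2)) with hs
  have hs0 : ∀ k, s k ≠ 0 := fun k => by positivity
  refine ⟨δ, μ, Matrix.diagonal (fun k => (s k : ℂ)) * (Uᴴ * R), ?_, ?_⟩
  · rw [Matrix.det_mul, Matrix.det_mul]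
    refine IsUnit.mul ?_ (IsUnit.mul ?_ hR)
    · rw [Matrix.det_diagonal]
      exact isUnit_iff_ne_zero.2 (Finset.prod_ne_zero_iff.2 fun k _ => by exact_mod_cast hs0 k)
    · have := congrArg Matrix.det hUU
      rw [Matrix.det_mul, Matrix.det_one] at this
      exact IsUnit.of_mul_eq_one_right _ this
  · have hA' : A = Complex.exp (δ * Complex.I) • B := by
      rw [hB, he, smul_smul, ← Complex.exp_add]
      simp
    have hD : Matrix.diagonal (fun k => (s k : ℂ)) *
        (Matrix.diagonal (fun k => Complex.exp ((δ + Real.arctan (μ k) : ℝ) * Complex.I)) *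
          Matrix.diagonal (fun k => (s k : ℂ))) =
        Complex.exp (δ * Complex.I) •
          (1 + Complex.I • Matrix.diagonal (fun k => (μ k : ℂ))) := by
      rw [Matrix.diagonal_mul_diagonal, Matrix.diagonal_mul_diagonal, ← Matrix.diagonal_one,
        ← Matrix.diagonal_smul, Matrix.diagonal_add, ← Matrix.diagonal_smul]
      congr 1
      funext k
      have h1 : (s k : ℂ) * s k = (√(1 + μ k ^ 2) : ℝ) := by
        rw [← Complex.ofReal_mul, Real.mul_self_sqrt (Real.sqrt_nonneg _)]
      have h2 := one_add_mul_I_eq (μ k)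
      simp only [Pi.smul_apply, smul_eq_mul]
      rw [mul_comm Complex.I, h2, Complex.ofReal_add, add_mul, Complex.exp_add, ← h1]
      ring
    have hstar : (Matrix.diagonal (fun k => (s k : ℂ)))ᴴ =
        Matrix.diagonal (fun k => (s k : ℂ)) := by
      rw [Matrix.diagonal_conjTranspose]
      congr 1
      funext k
      exact Complex.conj_ofReal _
    calc A = Complex.exp (δ * Complex.I) •
          (Rᴴ * (U * (1 + Complex.I • Matrix.diagonal (fun k => (μ k : ℂ))) * Uᴴ) * R) := by
          rw [hA', hBHK, hHR, hKK', hspec]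
          simp only [Matrix.mul_add, Matrix.add_mul, Matrix.mul_one, hUU, Matrix.mul_smul,
            Matrix.smul_mul]
      _ = (R.conjTranspose * U) * (Complex.exp (δ * Complex.I) •
          (1 + Complex.I • Matrix.diagonal (fun k => (μ k : ℂ)))) * (Uᴴ * R) := by
          simp only [Matrix.mul_smul, Matrix.smul_mul, Matrix.mul_assoc]
      _ = _ := by
          rw [← hD, Matrix.conjTranspose_mul, Matrix.conjTranspose_mul,
            Matrix.conjTranspose_conjTranspose, hstar]
          simp only [Matrix.mul_assoc]

lemma IsSectorial.exists_isPhaseVector [Nonempty n] {A : Matrix n n ℂ} (hA : IsSectorial A) :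
    ∃ φ : n → ℝ, IsPhaseVector A φ := by
  obtain ⟨δ, μ, T, hT, hAT⟩ := hA.exists_decomposition
  set ψ : n → ℝ := fun k => δ + Real.arctan (μ k) with hψ
  -- Shift by a multiple of `2π` to put the phase center into `(-π, π]`.
  obtain ⟨m, hm, -⟩ := existsUnique_add_zsmul_mem_Ioc Real.two_pi_pos
    (((⨆ k, ψ k) + ⨅ k, ψ k) / 2) (-Real.pi)
  refine ⟨fun k => ψ k + m • (2 * Real.pi), ⟨T, hT, ?_⟩, fun k l => ?_, ?_⟩
  · rw [hAT]
    congr 3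
    funext k
    have : ((ψ k + m • (2 * Real.pi) : ℝ) : ℂ) * Complex.I =
        (δ + Real.arctan (μ k) : ℝ) * Complex.I + m * (2 * Real.pi * Complex.I) := by
      simp only [hψ, zsmul_eq_mul]
      push_cast
      ring
    rw [this, Complex.exp_periodic.int_mul m]
  · have h1 := Real.arctan_lt_pi_div_two (μ k)
    have h2 := Real.neg_pi_div_two_lt_arctan (μ l)
    simp only [hψ]
    linarith
  · rw [← ciSup_add (Set.finite_range _).bddAbove, ← ciInf_add (Set.finite_range _).bddBelow]
    have : (((⨆ k, ψ k) + m • (2 * Real.pi)) + ((⨅ k, ψ k) + m • (2 * Real.pi))) / 2 =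
        ((⨆ k, ψ k) + ⨅ k, ψ k) / 2 + m • (2 * Real.pi) := by ring
    rw [this]
    exact ⟨hm.1, hm.2.trans_eq (by ring)⟩

/-- The normalization of the phase center bounds all phases, so that the supremum and the infimum
defining `maxPhase` and `minPhase` are over bounded sets. -/
lemma IsPhaseVector.abs_le {A : Matrix n n ℂ} {φ : n → ℝ} (h : IsPhaseVector A φ) (k : n) :
    |φ k| ≤ 2 * Real.pi := by
  have : Nonempty n := ⟨k⟩
  obtain ⟨i, hi⟩ := exists_eq_ciSup_of_finite (f := φ)
  obtain ⟨j, hj⟩ := exists_eq_ciInf_of_finite (f := φ)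
  have h1 : φ k ≤ φ i := hi ▸ le_ciSup (Set.finite_range φ).bddAbove k
  have h2 : φ j ≤ φ k := hj ▸ ciInf_le (Set.finite_range φ).bddBelow k
  have h3 := h.2.1 i j
  obtain ⟨h4, h5⟩ := h.2.2
  rw [← hi, ← hj] at h4 h5
  rw [_root_.abs_le]
  constructor <;> linarith

/-- The phases in a phase vector lie between the smallest and the largest phase. -/
lemma IsPhaseVector.mem_Icc {A : Matrix n n ℂ} {φ : n → ℝ} (h : IsPhaseVector A φ) (k : n) :
    φ k ∈ Set.Icc (minPhase A) (maxPhase A) := by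
  have hmem : φ k ∈ phases A := ⟨φ, h, k, rfl⟩
  constructor
  · refine csInf_le ⟨-(2 * Real.pi), ?_⟩ hmem
    rintro t ⟨ψ, hψ, l, rfl⟩
    exact (_root_.abs_le.1 (hψ.abs_le l)).1
  · refine le_csSup ⟨2 * Real.pi, ?_⟩ hmem
    rintro t ⟨ψ, hψ, l, rfl⟩
    exact (_root_.abs_le.1 (hψ.abs_le l)).2

/-- If all phases are within `π / 2` of `δ`, the rotated matrix `e^{-iδ} A` is accretive. -/
lemma IsSectorial.re_exp_mul_nonneg {A : Matrix n n ℂ} (hA : IsSectorial A) {δ : ℝ}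
    (hδ : ∀ t ∈ Set.Icc (minPhase A) (maxPhase A), 0 ≤ Real.cos (t - δ)) (x : n → ℂ) :
    0 ≤ (Complex.exp (-(δ * Complex.I)) * (star x ⬝ᵥ A *ᵥ x)).re := by
  cases isEmpty_or_nonempty n
  · simp [Subsingleton.elim x 0]
  obtain ⟨φ, hφ⟩ := hA.exists_isPhaseVector
  obtain ⟨T, -, hT⟩ := hφ.1
  have h1 : star x ⬝ᵥ A *ᵥ x =
      ∑ k, ((‖(T *ᵥ x) k‖ ^ 2 : ℝ) : ℂ) * Complex.exp (φ k * Complex.I) := by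
    conv_lhs => rw [hT]
    rw [← Matrix.mulVec_mulVec, ← Matrix.mulVec_mulVec, Matrix.dotProduct_mulVec,
      ← Matrix.star_mulVec]
    simp only [dotProduct, Matrix.mulVec_diagonal, Pi.star_apply]
    refine Finset.sum_congr rfl fun k _ => ?_
    push_cast
    rw [← Complex.conj_mul', Complex.star_def]
    ring
  rw [h1, Finset.mul_sum, Complex.re_sum]
  refine Finset.sum_nonneg fun k _ => ?_
  have h2 : Complex.exp (-(δ * Complex.I)) *
      (((‖(T *ᵥ x) k‖ ^ 2 : ℝ) : ℂ) * Complex.exp (φ k * Complex.I)) =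
      ((‖(T *ᵥ x) k‖ ^ 2 : ℝ) : ℂ) * Complex.exp ((φ k - δ : ℝ) * Complex.I) := by
    rw [mul_left_comm, ← Complex.exp_add]
    congr 2
    push_cast
    ring
  rw [h2, Complex.re_ofReal_mul, Complex.exp_ofReal_mul_I_re]
  exact mul_nonneg (sq_nonneg _) (hδ _ (hφ.mem_Icc k))

end phases

/-- Finitely many intervals contained in `(-π, π)` and jointly of width less than `π` lie in a
half-plane of directions `|t - δ| ≤ π / 2` that does not contain the direction `π`. -/
lemma exists_common_direction {ι : Type*} [Finite ι] [Nonempty ι] (lo hi : ι → ℝ)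
    (hhi : ∀ i, hi i < Real.pi) (hlo : ∀ i, -Real.pi < lo i)
    (hw : ∀ i j, hi i - lo j < Real.pi) :
    ∃ δ : ℝ, 0 < Real.cos δ ∧ ∀ i, ∀ t ∈ Set.Icc (lo i) (hi i), 0 ≤ Real.cos (t - δ) := by
  obtain ⟨i₀, hi₀⟩ := Finite.exists_max hi
  obtain ⟨j₀, hj₀⟩ := Finite.exists_min lo
  -- Any `δ` strictly between these bounds works.
  have hlt : max (hi i₀ - Real.pi / 2) (-(Real.pi / 2)) <
      min (lo j₀ + Real.pi / 2) (Real.pi / 2) := by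
    have h1 := hhi i₀
    have h2 := hlo j₀
    have h3 := hw i₀ j₀
    have h4 := Real.pi_pos
    rw [max_lt_iff, lt_min_iff, lt_min_iff]
    refine ⟨⟨?_, ?_⟩, ?_, ?_⟩ <;> linarith
  obtain ⟨δ, h1, h2⟩ := exists_between hlt
  rw [max_lt_iff] at h1
  rw [lt_min_iff] at h2
  refine ⟨δ, Real.cos_pos_of_mem_Ioo ⟨h1.2, h2.2⟩, fun i t ht => ?_⟩
  have h3 := hi₀ i
  have h4 := hj₀ i
  exact Real.cos_nonneg_of_neg_pi_div_two_le_of_le (by linarith [ht.1]) (by linarith [ht.2])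

/-! ### Positive definiteness of grounded Laplacians and Schur complements -/

section laplacian
variable {V : Type*} [Fintype V] [DecidableEq V]

/-- The energy identity: with the grounded node at potential `0`, the quadratic form of the
grounded Laplacian is half the sum of `w p q (x p - x q) ^ 2` over all pairs of nodes. -/
lemma two_mul_groundedLaplacian_form {w : Option V → Option V → ℝ} (hsymm : ∀ p q, w p q = w q p)
    (hloop : ∀ p, w p p = 0) (x : V → ℝ) :
    2 * (x ⬝ᵥ groundedLaplacian w *ᵥ x) =
      ∑ p : Option V, ∑ q : Option V, w p q * (p.elim 0 x - q.elim 0 x) ^ 2 := by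
  set y : Option V → ℝ := fun p => p.elim 0 x with hy
  have hrow : ∀ i, (groundedLaplacian w *ᵥ x) i =
      ∑ q : Option V, w (some i) q * (y (some i) - y q) := by
    intro i
    have hentry : ∀ j, groundedLaplacian w i j =
        (if i = j then ∑ k : Option V, w (some i) k else 0) - w (some i) (some j) := by
      intro j
      by_cases h : i = j
      · subst h; simp [groundedLaplacian, hloop]
      · simp [groundedLaplacian, h]
    simp only [Matrix.mulVec, dotProduct, hentry, sub_mul, ite_mul, zero_mul,
      Finset.sum_sub_distrib, Finset.sum_ite_eq, Finset.mem_univ, if_true, mul_sub]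
    congr 1
    · rw [Finset.sum_mul]; rfl
    · rw [Fintype.sum_option]; simp [hy]
  have h1 : x ⬝ᵥ groundedLaplacian w *ᵥ x =
      ∑ p : Option V, ∑ q : Option V, w p q * (y p * (y p - y q)) := by
    rw [Fintype.sum_option]
    simp only [dotProduct, hrow, Finset.mul_sum]
    have h0 : ∑ q : Option V, w none q * (y none * (y none - y q)) = 0 := by simp [hy]
    rw [h0, zero_add]
    refine Finset.sum_congr rfl fun i _ => Finset.sum_congr rfl fun q _ => ?_
    rw [mul_left_comm]; rfl
  have h2 : x ⬝ᵥ groundedLaplacian w *ᵥ x =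
      ∑ p : Option V, ∑ q : Option V, w p q * (y q * (y q - y p)) := by
    rw [h1, Finset.sum_comm]
    refine Finset.sum_congr rfl fun p _ => Finset.sum_congr rfl fun q _ => ?_
    rw [hsymm]
  rw [two_mul]
  nth_rw 1 [h1]
  rw [h2, ← Finset.sum_add_distrib]
  refine Finset.sum_congr rfl fun p _ => ?_
  rw [← Finset.sum_add_distrib]
  exact Finset.sum_congr rfl fun q _ => by ring

lemma groundedLaplacian_posDef {w : Option V → Option V → ℝ} (hsymm : ∀ p q, w p q = w q p)
    (hloop : ∀ p, w p p = 0) (hnonneg : ∀ p q, 0 ≤ w p q) {G : SimpleGraph (Option V)}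
    (hG : G.Connected) (hpos : ∀ p q, G.Adj p q → 0 < w p q) : (groundedLaplacian w).PosDef := by
  refine Matrix.PosDef.of_dotProduct_mulVec_pos ?_ fun x hx => ?_
  · ext i j
    by_cases h : i = j
    · subst h; simp
    · simp [groundedLaplacian, h, Ne.symm h, hsymm (some i)]
  rw [star_trivial]
  have hE := two_mul_groundedLaplacian_form hsymm hloop x
  have hterm : ∀ p q : Option V, 0 ≤ w p q * (p.elim 0 x - q.elim 0 x) ^ 2 := fun p q =>
    mul_nonneg (hnonneg p q) (sq_nonneg _)
  have h0 : 0 ≤ ∑ p : Option V, ∑ q : Option V, w p q * (p.elim 0 x - q.elim 0 x) ^ 2 :=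
    Finset.sum_nonneg fun p _ => Finset.sum_nonneg fun q _ => hterm p q
  refine lt_of_le_of_ne (by linarith) fun h => hx ?_
  rw [← h, mul_zero, eq_comm, Finset.sum_eq_zero_iff_of_nonneg
    (fun p _ => Finset.sum_nonneg fun q _ => hterm p q)] at hE
  -- Zero energy forces equal potentials along every line.
  have hadj : ∀ p q, G.Adj p q → p.elim 0 x = q.elim 0 x := by
    intro p q hpq
    have h1 := (Finset.sum_eq_zero_iff_of_nonneg (fun q _ => hterm p q)).1
      (hE p (Finset.mem_univ _)) q (Finset.mem_univ _)
    have h2 := (mul_eq_zero.1 h1).resolve_left (hpos p q hpq).ne'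
    exact sub_eq_zero.1 (pow_eq_zero_iff two_ne_zero |>.1 h2)
  funext i
  obtain ⟨walk⟩ := hG.preconnected (some i) none
  have : ∀ {p q : Option V}, G.Walk p q → p.elim 0 x = q.elim 0 x := by
    intro p q W
    induction W with
    | nil => rfl
    | cons h _ ih => exact (hadj _ _ h).trans ih
  exact this walk

end laplacian

section schur
variable {α β : Type*}

lemma toBlocks₂₂_posDef {A : Matrix (α ⊕ β) (α ⊕ β) ℝ} (hA : A.PosDef) : A.toBlocks₂₂.PosDef :=
  hA.submatrix Sum.inr_injective

lemma kronReduction_posDef [Fintype α] [Fintype β] [DecidableEq β]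
    {A : Matrix (α ⊕ β) (α ⊕ β) ℝ} (hA : A.PosDef) :
    (kronReduction A).PosDef := by
  have hD := toBlocks₂₂_posDef hA
  have hB : A.toBlocks₂₁ = A.toBlocks₁₂ᴴ := by
    ext i j
    exact (hA.1.apply (Sum.inr i) (Sum.inl j)).symm
  have hA' : A = Matrix.fromBlocks A.toBlocks₁₁ A.toBlocks₁₂ A.toBlocks₁₂ᴴ A.toBlocks₂₂ := by
    rw [← hB, Matrix.fromBlocks_toBlocks]
  have : Invertible A.toBlocks₂₂ :=
    Matrix.invertibleOfIsUnitDet _ (isUnit_iff_ne_zero.2 hD.det_pos.ne')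
  have hS : kronReduction A = A.toBlocks₁₁ - A.toBlocks₁₂ * A.toBlocks₂₂⁻¹ * A.toBlocks₁₂ᴴ := by
    rw [kronReduction, hB]
  have h11 : A.toBlocks₁₁.IsHermitian := (hA.submatrix (e := Sum.inl) Sum.inl_injective).1
  refine Matrix.PosDef.of_dotProduct_mulVec_pos ?_ fun x hx => ?_
  · rw [hS]
    exact h11.sub (Matrix.isHermitian_mul_mul_conjTranspose _ hD.1.inv)
  · -- The reduced form at `x` is the full form at the minimizing extension of `x`.
    set y := -((A.toBlocks₂₂⁻¹ * A.toBlocks₁₂ᴴ) *ᵥ x) with hy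
    have h1 := Matrix.schur_complement_eq₂₂ A.toBlocks₁₁ A.toBlocks₁₂ x y hD.1
    rw [← hA', ← hS, hy, add_neg_cancel, star_zero, Matrix.zero_vecMul, zero_dotProduct, zero_add,
      ← Matrix.dotProduct_mulVec, ← Matrix.dotProduct_mulVec] at h1
    rw [← h1]
    refine hA.dotProduct_mulVec_pos fun h => hx ?_
    funext i
    exact congrFun h (Sum.inl i)

end schur

namespace RLNetwork
variable {N K : ℕ} (net : RLNetwork N K)

lemma groundedLaplacian_susceptance_posDef : (groundedLaplacian net.susceptance).PosDef := by
  refine groundedLaplacian_posDef ?_ ?_ ?_ net.connected ?_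
  · intro p q
    by_cases h : net.lines.Adj p q
    · simp [susceptance, h, h.symm, net.X_symm p q]
    · simp [susceptance, h, mt SimpleGraph.Adj.symm h]
  · intro p
    simp [susceptance]
  · intro p q
    rw [susceptance]
    split_ifs with h
    · exact (one_div_pos.2 (net.X_pos _ _ h)).le
    · exact le_rfl
  · intro p q h
    rw [susceptance, if_pos h]
    exact one_div_pos.2 (net.X_pos _ _ h)

lemma reducedLaplacian_posDef : net.reducedLaplacian.PosDef :=
  kronReduction_posDef net.groundedLaplacian_susceptance_posDef

end RLNetwork

/-! ### The network admittance -/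

lemma isUnit_det_lineF_inv (ω₀ ε : ℝ) :
    IsUnit (!![RatFunc.X / RatFunc.C ω₀ + RatFunc.C ε, -1;
      1, RatFunc.X / RatFunc.C ω₀ + RatFunc.C ε] : Matrix (Fin 2) (Fin 2) TF).det := by
  have h : (!![RatFunc.X / RatFunc.C ω₀ + RatFunc.C ε, -1;
      1, RatFunc.X / RatFunc.C ω₀ + RatFunc.C ε] : Matrix (Fin 2) (Fin 2) TF).det =
      algebraMap (Polynomial ℝ) TF
        ((Polynomial.X * Polynomial.C ω₀⁻¹ + Polynomial.C ε) ^ 2 + 1) := by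
    rw [Matrix.det_fin_two_of]
    simp only [map_add, map_mul, map_pow, RatFunc.algebraMap_X, RatFunc.algebraMap_C, map_one,
      map_inv₀, div_eq_mul_inv]
    ring
  rw [h, isUnit_iff_ne_zero]
  refine RatFunc.algebraMap_ne_zero fun h0 => ?_
  have := congrArg (Polynomial.eval 0) h0
  simp at this
  nlinarith [sq_nonneg ε]

lemma isUnit_det_lineF (ω₀ ε : ℝ) : IsUnit (lineF ω₀ ε).det := by
  rw [lineF, Matrix.det_nonsing_inv]
  exact (isUnit_det_lineF_inv ω₀ ε).ringInverse

lemma lineF_inv (ω₀ ε : ℝ) : (lineF ω₀ ε)⁻¹ =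
    !![RatFunc.X / RatFunc.C ω₀ + RatFunc.C ε, -1; 1, RatFunc.X / RatFunc.C ω₀ + RatFunc.C ε] :=
  Matrix.nonsing_inv_nonsing_inv _ (isUnit_det_lineF_inv ω₀ ε)

lemma map_C_inv {n : Type*} [Fintype n] [DecidableEq n] {A : Matrix n n ℝ} (hA : IsUnit A.det) :
    (A.map RatFunc.C : Matrix n n TF)⁻¹ = A⁻¹.map RatFunc.C := by
  refine Matrix.inv_eq_right_inv ?_
  rw [← Matrix.map_mul, Matrix.mul_nonsing_inv A hA]
  exact Matrix.map_one _ (map_zero _) (map_one _)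

/-- The Kron reduction of `A ⊗ F` is that of `A`, tensored with `F`. -/
lemma kronReduction_kronecker {α β : Type*} [Fintype β] [DecidableEq β]
    {A : Matrix (α ⊕ β) (α ⊕ β) ℝ} (hA : IsUnit A.toBlocks₂₂.det)
    {F : Matrix (Fin 2) (Fin 2) TF} (hF : IsUnit F.det) :
    kronReduction (((A.map RatFunc.C) ⊗ₖ F).reindex (Equiv.sumProdDistrib α β (Fin 2))
      (Equiv.sumProdDistrib α β (Fin 2))) = (kronReduction A).map RatFunc.C ⊗ₖ F := by
  set M := ((A.map RatFunc.C) ⊗ₖ F).reindex (Equiv.sumProdDistrib α β (Fin 2))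
      (Equiv.sumProdDistrib α β (Fin 2)) with hM
  have h11 : M.toBlocks₁₁ = A.toBlocks₁₁.map RatFunc.C ⊗ₖ F := rfl
  have h12 : M.toBlocks₁₂ = A.toBlocks₁₂.map RatFunc.C ⊗ₖ F := rfl
  have h21 : M.toBlocks₂₁ = A.toBlocks₂₁.map RatFunc.C ⊗ₖ F := rfl
  have h22 : M.toBlocks₂₂ = A.toBlocks₂₂.map RatFunc.C ⊗ₖ F := rfl
  rw [kronReduction, h11, h12, h21, h22, Matrix.inv_kronecker, map_C_inv hA,
    ← Matrix.mul_kronecker_mul, ← Matrix.mul_kronecker_mul, Matrix.mul_nonsing_inv F hF,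
    Matrix.one_mul, ← Matrix.map_mul, ← Matrix.map_mul, kronReduction]
  generalize A.toBlocks₁₂ * A.toBlocks₂₂⁻¹ * A.toBlocks₂₁ = Q
  ext ⟨i, k⟩ ⟨j, l⟩
  simp [sub_mul]

lemma RLNetwork.gridAdmittance_eq {N K : ℕ} (net : RLNetwork N K) (ω₀ : ℝ) {ε : ℝ}
    (hε : net.HasRXRatio ε) :
    net.gridAdmittance ω₀ = net.reducedLaplacian.map RatFunc.C ⊗ₖ lineF ω₀ ε := by
  have hline : ∀ i j, net.lineAdmittance ω₀ i j =
      (RatFunc.C (net.susceptance i j) : TF) • lineF ω₀ ε := by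
    intro i j
    rw [lineAdmittance]
    by_cases h : net.lines.Adj i j
    · rw [hε i j h]
    · simp [susceptance, h]
  have hL : blockLaplacian (net.lineAdmittance ω₀) =
      (groundedLaplacian net.susceptance).map RatFunc.C ⊗ₖ lineF ω₀ ε := by
    ext ⟨i, k⟩ ⟨j, l⟩
    by_cases h : i = j
    · subst h
      simp [blockLaplacian, groundedLaplacian, hline, Matrix.sum_apply, ← Finset.sum_mul, add_mul]
    · simp [blockLaplacian, groundedLaplacian, hline, h]
  rw [gridAdmittance, hL, kronReduction_kronecker _ (isUnit_det_lineF ω₀ ε)]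
  · rfl
  · exact isUnit_iff_ne_zero.2
      (toBlocks₂₂_posDef net.groundedLaplacian_susceptance_posDef).det_pos.ne'

/-! ### Gains as Rayleigh bounds -/

section gains
variable {𝕜 : Type*} [RCLike 𝕜] {n : ℕ}

open LinearMap in
/-- `‖A x‖ ^ 2` is the weighted sum of the squared singular values of `A`, with the squared
coordinates of `x` in a basis of right singular vectors as weights. -/
lemma norm_sq_toEuclideanLin_eq_sum (A : Matrix (Fin n) (Fin n) 𝕜) :
    ∃ b : OrthonormalBasis (Fin n) 𝕜 (EuclideanSpace 𝕜 (Fin n)), ∀ x,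
      ‖Matrix.toEuclideanLin A x‖ ^ 2 =
        ∑ i : Fin n, (Matrix.toEuclideanLin A).singularValues i ^ 2 * ‖b.repr x i‖ ^ 2 := by
  set T := Matrix.toEuclideanLin A with hT
  have hn : Module.finrank 𝕜 (EuclideanSpace 𝕜 (Fin n)) = n := by simp
  have hS := T.isSymmetric_adjoint_comp_self
  refine ⟨hS.eigenvectorBasis hn, fun x => ?_⟩
  set b := hS.eigenvectorBasis hn with hb
  have h1 : ((‖T x‖ ^ 2 : ℝ) : 𝕜) = inner 𝕜 x ((adjoint T ∘ₗ T) x) := by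
    rw [comp_apply, adjoint_inner_right, inner_self_eq_norm_sq_to_K]
    push_cast
    rfl
  have h2 : inner 𝕜 x ((adjoint T ∘ₗ T) x) =
      ((∑ i : Fin n, T.singularValues i ^ 2 * ‖b.repr x i‖ ^ 2 : ℝ) : 𝕜) := by
    rw [← b.repr.inner_map_map, PiLp.inner_apply, RCLike.ofReal_sum]
    refine Finset.sum_congr rfl fun i _ => ?_
    rw [hb, hS.eigenvectorBasis_apply_self_apply hn x i, T.sq_singularValues_fin hn i,
      RCLike.inner_apply, mul_assoc, RCLike.mul_conj]
    push_cast
    rfl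
  exact RCLike.ofReal_injective (h1.trans h2)

lemma norm_toEuclideanLin_le_maxGain (A : Matrix (Fin n) (Fin n) 𝕜)
    (x : EuclideanSpace 𝕜 (Fin n)) : ‖Matrix.toEuclideanLin A x‖ ≤ maxGain A * ‖x‖ := by
  have h0 : 0 ≤ maxGain A := LinearMap.singularValues_nonneg _ _
  refine (sq_le_sq₀ (norm_nonneg _) (by positivity)).1 ?_
  obtain ⟨b, hb⟩ := norm_sq_toEuclideanLin_eq_sum A
  rw [hb, mul_pow, ← b.repr.norm_map x, EuclideanSpace.norm_sq_eq, Finset.mul_sum]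
  refine Finset.sum_le_sum fun i _ => ?_
  have h1 := (Matrix.toEuclideanLin A).singularValues_antitone (Nat.zero_le (i : ℕ))
  have h2 := (Matrix.toEuclideanLin A).singularValues_nonneg i
  rw [maxGain]
  gcongr

lemma minGain_le_norm_toEuclideanLin (A : Matrix (Fin n) (Fin n) 𝕜)
    (x : EuclideanSpace 𝕜 (Fin n)) : minGain A * ‖x‖ ≤ ‖Matrix.toEuclideanLin A x‖ := by
  have h0 : 0 ≤ minGain A := LinearMap.singularValues_nonneg _ _
  refine (sq_le_sq₀ (by positivity) (norm_nonneg _)).1 ?_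
  obtain ⟨b, hb⟩ := norm_sq_toEuclideanLin_eq_sum A
  rw [hb, mul_pow, ← b.repr.norm_map x, EuclideanSpace.norm_sq_eq, Finset.mul_sum]
  refine Finset.sum_le_sum fun i _ => ?_
  have h1 := (Matrix.toEuclideanLin A).singularValues_antitone (show (i : ℕ) ≤ n - 1 by omega)
  rw [minGain]
  rw [minGain] at h0
  gcongr

lemma norm_dotProduct_mulVec_le_maxGain (A : Matrix (Fin n) (Fin n) ℂ) (x : Fin n → ℂ) :
    ‖star x ⬝ᵥ A *ᵥ x‖ ≤ maxGain A * (star x ⬝ᵥ x).re := by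
  have h1 := norm_toEuclideanLin_le_maxGain A (WithLp.toLp 2 x)
  have h2 := norm_inner_le_norm (𝕜 := ℂ) (WithLp.toLp 2 x)
    (Matrix.toEuclideanLin A (WithLp.toLp 2 x))
  rw [inner_toEuclideanLin] at h2
  have h3 := congrArg Complex.re (norm_sq_eq_star_dotProduct (WithLp.toLp 2 x))
  rw [Complex.ofReal_re] at h3
  rw [← h3]
  refine h2.trans ((mul_le_mul_of_nonneg_left h1 (norm_nonneg _)).trans_eq ?_)
  ring

end gains

/-! ### The generalized short-circuit ratio -/

section gscr

open scoped Pointwise in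
/-- The smallest eigenvalue `g` of a positive definite `P` is its smallest singular value, and
`P - g I` is positive semidefinite. -/
lemma exists_isLeast_spectrum {n : ℕ} (hn : 0 < n) {P : Matrix (Fin n) (Fin n) ℝ}
    (hP : P.PosDef) :
    ∃ g : ℝ, 0 < g ∧ IsLeast (spectrum ℝ P) g ∧ g = minGain P ∧
      ∃ B : Matrix (Fin n) (Fin n) ℝ, P = g • 1 + Bᵀ * B := by
  have : Nonempty (Fin n) := ⟨⟨0, hn⟩⟩
  obtain ⟨i₀, hi₀⟩ := Finite.exists_min hP.1.eigenvalues
  set g := hP.1.eigenvalues i₀ with hg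
  have hg0 : 0 < g := hP.eigenvalues_pos i₀
  have hleast : IsLeast (spectrum ℝ P) g := by
    rw [hP.1.spectrum_real_eq_range_eigenvalues]
    refine ⟨⟨i₀, rfl⟩, ?_⟩
    rintro _ ⟨i, rfl⟩
    exact hi₀ i
  have hpsd : (P - g • (1 : Matrix (Fin n) (Fin n) ℝ)).PosSemidef := by
    have hherm : (P - g • (1 : Matrix (Fin n) (Fin n) ℝ)).IsHermitian :=
      hP.1.sub (by simp [Matrix.IsHermitian])
    refine hherm.posSemidef_iff_eigenvalues_nonneg.2 fun i => ?_
    have hmem := hherm.eigenvalues_mem_spectrum_real i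
    have hspec : spectrum ℝ (P - g • (1 : Matrix (Fin n) (Fin n) ℝ)) =
        spectrum ℝ P - ({g} : Set ℝ) := by
      rw [← Algebra.algebraMap_eq_smul_one, ← spectrum.sub_singleton_eq]
    rw [hspec] at hmem
    obtain ⟨a, ha, c, rfl, h⟩ := hmem
    rw [Pi.zero_apply, ← h]
    exact sub_nonneg.2 (hleast.2 ha)
  obtain ⟨B, hB⟩ : ∃ B : Matrix (Fin n) (Fin n) ℝ, P - g • 1 = Bᵀ * B := by
    open scoped MatrixOrder in
    exact CStarAlgebra.nonneg_iff_eq_star_mul_self.1 (Matrix.nonneg_iff_posSemidef.2 hpsd)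
  have hPB : P = g • 1 + Bᵀ * B := by rw [← hB]; abel
  refine ⟨g, hg0, hleast, ?_, B, hPB⟩
  set T := Matrix.toEuclideanLin P with hT
  have hlow : ∀ x : EuclideanSpace ℝ (Fin n), g * ‖x‖ ≤ ‖T x‖ := by
    intro x
    rcases eq_or_ne x 0 with rfl | hx
    · simp
    have h1 : inner ℝ x (T x) = g * ‖x‖ ^ 2 + ‖Matrix.toEuclideanLin B x‖ ^ 2 := by
      rw [← real_inner_self_eq_norm_sq, ← real_inner_self_eq_norm_sq,
        EuclideanSpace.inner_eq_star_dotProduct, EuclideanSpace.inner_eq_star_dotProduct,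
        EuclideanSpace.inner_eq_star_dotProduct, star_trivial, star_trivial]
      change (P *ᵥ x.ofLp) ⬝ᵥ x.ofLp = g * (x.ofLp ⬝ᵥ x.ofLp) + (B *ᵥ x.ofLp) ⬝ᵥ (B *ᵥ x.ofLp)
      rw [hPB, Matrix.add_mulVec, add_dotProduct, Matrix.smul_mulVec, Matrix.one_mulVec,
        smul_dotProduct, smul_eq_mul, ← Matrix.mulVec_mulVec, Matrix.mulVec_transpose,
        ← Matrix.dotProduct_mulVec]
    have h2 := real_inner_le_norm x (T x)
    have h3 := norm_pos_iff.2 hx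
    refine le_of_mul_le_mul_left ?_ h3
    nlinarith [sq_nonneg ‖Matrix.toEuclideanLin B x‖]
  apply le_antisymm
  · -- Evaluate the lower bound at a right singular vector of the smallest singular value.
    obtain ⟨b, hb⟩ := norm_sq_toEuclideanLin_eq_sum P
    have h0 : 0 ≤ minGain P := LinearMap.singularValues_nonneg _ _
    have h1 := hlow (b ⟨n - 1, by omega⟩)
    have h2 := hb (b ⟨n - 1, by omega⟩)
    rw [Finset.sum_eq_single ⟨n - 1, by omega⟩ (fun j _ hj => by simp [hj]) (by simp)] at h2
    simp only [OrthonormalBasis.repr_self, PiLp.single_apply, if_true, norm_one, one_pow,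
      mul_one] at h2
    rw [b.orthonormal.1, mul_one] at h1
    exact h1.trans ((sq_eq_sq₀ (norm_nonneg _) h0).1 h2).le
  · -- Evaluate the smallest gain at an eigenvector of `g`.
    set v := hP.1.eigenvectorBasis i₀ with hv
    have hv1 : ‖v‖ = 1 := hP.1.eigenvectorBasis.orthonormal.1 i₀
    have h1 := minGain_le_norm_toEuclideanLin P v
    have h2 : T v = g • v := by
      ext i
      exact congrFun (hP.1.mulVec_eigenvectorBasis i₀) i
    rw [← hT, h2, norm_smul, hv1, mul_one, mul_one, Real.norm_eq_abs, abs_of_pos hg0] at h1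
    exact h1

end gscr

/-! ### The rescaled network -/

section grid
variable {N K : ℕ} (net : RLNetwork N K) {S : Fin N → ℝ}

lemma invSqrtDiag_mul_self (hS : ∀ i, 0 < S i) :
    invSqrtDiag S * invSqrtDiag S = (Matrix.diagonal S)⁻¹ := by
  symm
  refine Matrix.inv_eq_right_inv ?_
  rw [invSqrtDiag, Matrix.diagonal_mul_diagonal, Matrix.diagonal_mul_diagonal,
    ← Matrix.diagonal_one]
  congr 1
  funext i
  rw [← mul_inv, Real.mul_self_sqrt (hS i).le, mul_inv_cancel₀ (hS i).ne']

lemma isUnit_invSqrtDiag (hS : ∀ i, 0 < S i) : IsUnit (invSqrtDiag S) := by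
  rw [Matrix.isUnit_iff_isUnit_det, invSqrtDiag, Matrix.det_diagonal, isUnit_iff_ne_zero]
  exact Finset.prod_ne_zero_iff.2 fun i _ => inv_ne_zero (Real.sqrt_pos.2 (hS i)).ne'

/-- The symmetrically rescaled Laplacian `S^(-1/2) B_r S^(-1/2)`. -/
def scaledLaplacian (net : RLNetwork N K) (S : Fin N → ℝ) : Matrix (Fin N) (Fin N) ℝ :=
  invSqrtDiag S * net.reducedLaplacian * invSqrtDiag S

lemma scaledLaplacian_posDef (hS : ∀ i, 0 < S i) : (scaledLaplacian net S).PosDef := by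
  have h : (invSqrtDiag S)ᴴ = invSqrtDiag S := by
    rw [invSqrtDiag, Matrix.diagonal_conjTranspose, star_trivial]
  have := net.reducedLaplacian_posDef.conjTranspose_mul_mul_same
    (Matrix.mulVec_injective_of_isUnit (isUnit_invSqrtDiag hS))
  rwa [h] at this

lemma gridEigenvalues_eq_spectrum (hS : ∀ i, 0 < S i) :
    net.gridEigenvalues S = spectrum ℝ (scaledLaplacian net S) := by
  obtain ⟨u, hu⟩ := isUnit_invSqrtDiag hS
  have h : (Matrix.diagonal S)⁻¹ * net.reducedLaplacian =
      u * scaledLaplacian net S * (↑u⁻¹ : Matrix (Fin N) (Fin N) ℝ) := by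
    rw [scaledLaplacian, ← hu, ← mul_assoc, ← mul_assoc, mul_assoc _ (u : Matrix (Fin N) (Fin N) ℝ),
      Units.mul_inv, mul_one, hu, invSqrtDiag_mul_self hS]
  ext μ
  rw [RLNetwork.gridEigenvalues, Set.mem_ofPred_eq, Module.End.hasEigenvalue_iff_mem_spectrum,
    Matrix.spectrum_toLin', h, spectrum.units_conjugate]

lemma rescaledGrid_eq (ω₀ : ℝ) {ε : ℝ} (hε : net.HasRXRatio ε) (S : Fin N → ℝ) :
    rescaledGrid net ω₀ ε S = (scaledLaplacian net S).map RatFunc.C ⊗ₖ 1 := by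
  rw [rescaledGrid, net.gridAdmittance_eq ω₀ hε, ← Matrix.mul_kronecker_mul,
    ← Matrix.mul_kronecker_mul, Matrix.one_mul, Matrix.mul_nonsing_inv _ (isUnit_det_lineF ω₀ ε),
    ← Matrix.map_mul, ← Matrix.map_mul]
  rfl

lemma rescaledGrid_inv_eq (ω₀ : ℝ) {ε : ℝ} (hε : net.HasRXRatio ε) (hS : ∀ i, 0 < S i) :
    (rescaledGrid net ω₀ ε S)⁻¹ = (scaledLaplacian net S)⁻¹.map RatFunc.C ⊗ₖ 1 := by
  rw [rescaledGrid_eq net ω₀ hε, Matrix.inv_kronecker, inv_one,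
    map_C_inv (isUnit_iff_ne_zero.2 (scaledLaplacian_posDef net hS).det_pos.ne')]

end grid

/-! ### The converter side -/

section converter
variable {N : ℕ}

lemma blockDiag_mul (A B : Fin N → Matrix (Fin 2) (Fin 2) TF) :
    blockDiag A * blockDiag B = blockDiag fun i => A i * B i := by
  rw [blockDiag, blockDiag, blockDiag, Matrix.blockDiagonal_mul]
  exact Matrix.submatrix_mul_equiv _ _ _ (Equiv.prodComm _ _) _

lemma one_kronecker_eq_blockDiag (A : Matrix (Fin 2) (Fin 2) TF) :
    (1 : Matrix (Fin N) (Fin N) TF) ⊗ₖ A = blockDiag fun _ => A := by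
  ext ⟨i, k⟩ ⟨j, l⟩
  simp [blockDiag, Matrix.blockDiagonal_apply, Matrix.one_apply]

/-- Rotations commute with the line dynamics. -/
lemma rot_mul_lineF_inv (ω₀ ε θ : ℝ) : rot θ * (lineF ω₀ ε)⁻¹ = (lineF ω₀ ε)⁻¹ * rot θ := by
  rw [lineF_inv, rot]
  ext i j
  fin_cases i <;> fin_cases j <;> simp [Matrix.mul_apply, Fin.sum_univ_two] <;> ring

lemma converterSide_eq (ω₀ ε : ℝ) (θ : Fin N → ℝ) (YC : Fin N → Matrix (Fin 2) (Fin 2) TF) :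
    converterSide ω₀ ε θ YC =
      blockDiag fun i => rot (θ i) * (rescaledConverter ω₀ ε (YC i) * rot (-θ i)) := by
  rw [converterSide, one_kronecker_eq_blockDiag, blockDiag_mul, blockDiag_mul, blockDiag_mul]
  congr 1
  funext i
  rw [Matrix.mul_assoc, rot_mul_lineF_inv, rescaledConverter]
  simp only [Matrix.mul_assoc]

lemma isRHInf_rot (θ : ℝ) : IsRHInf (rot θ) := fun i j => by
  rw [rot, Matrix.map_apply]
  exact isRHInfEntry_C _

lemma isRHInf_blockDiag {A : Fin N → Matrix (Fin 2) (Fin 2) TF} (hA : ∀ i, IsRHInf (A i)) :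
    IsRHInf (blockDiag A) := by
  rintro ⟨i, k⟩ ⟨j, l⟩
  rw [blockDiag, Matrix.submatrix_apply, Prod.swap_prod_mk, Prod.swap_prod_mk,
    Matrix.blockDiagonal_apply]
  split_ifs
  · exact hA _ _ _
  · exact rhInf.zero_mem

end converter

/-! ### Frequency responses -/

lemma exists_diskValue_eq_freqValue (ω : ℝ≥0∞) :
    ∃ w : ℂ, ‖w‖ ≤ 1 ∧ ∀ f : TF, IsRHInfEntry f → freqValue f ω = diskValue f w := by
  by_cases h : ω = ⊤
  · subst h
    exact ⟨-1, by simp, fun f _ => (diskValue_neg_one f).symm⟩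
  set s : ℂ := Complex.I * ω.toReal with hs
  have hre : s.re = 0 := by simp [hs]
  have h1 : 1 + s ≠ 0 := by
    intro h0
    have := congrArg Complex.re h0
    simp [hre] at this
  have e1 : 1 + (1 - s) / (1 + s) = 2 / (1 + s) := by field_simp; ring
  have e2 : 1 - (1 - s) / (1 + s) = 2 * s / (1 + s) := by field_simp; ring
  refine ⟨(1 - s) / (1 + s), ?_, fun f hf => ?_⟩
  · rw [norm_div, div_le_one (norm_pos_iff.2 h1), ← sq_le_sq₀ (norm_nonneg _) (norm_nonneg _),
      ← Complex.normSq_eq_norm_sq, ← Complex.normSq_eq_norm_sq, Complex.normSq_apply,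
      Complex.normSq_apply]
    simp [hre]
  · rw [diskValue_eq_freqValue hf (ω := ω.toReal) _ ENNReal.toReal_nonneg, ENNReal.ofReal_toReal h]
    · rw [e1, e2, div_div_div_cancel_right₀ h1, mul_div_cancel_left₀ _ two_ne_zero]
    · rw [e1]
      exact div_ne_zero two_ne_zero h1

lemma freqValue_C (r : ℝ) (ω : ℝ≥0∞) : freqValue (RatFunc.C r) ω = r := by
  obtain ⟨w, -, h⟩ := exists_diskValue_eq_freqValue ω
  rw [h _ (isRHInfEntry_C r), diskValue_C]

lemma freqResp_mul {m n p : Type*} [Fintype n] {A : Matrix m n TF} {B : Matrix n p TF}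
    (hA : IsRHInf A) (hB : IsRHInf B) (ω : ℝ≥0∞) :
    freqResp (A * B) ω = freqResp A ω * freqResp B ω := by
  obtain ⟨w, hw, h⟩ := exists_diskValue_eq_freqValue ω
  ext i j
  have hsum : ((∑ k, (⟨A i k, hA i k⟩ * ⟨B k j, hB k j⟩ : rhInf) : rhInf) : TF) =
      ∑ k, A i k * B k j := AddSubmonoidClass.coe_finsetSum _ _
  have e := map_sum (diskEval w hw) (fun k => (⟨A i k, hA i k⟩ * ⟨B k j, hB k j⟩ : rhInf))
    Finset.univ
  rw [diskEval_apply, hsum, ← h _ (rhInf.sum_mem fun k _ => rhInf.mul_mem (hA i k) (hB k j))] at e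
  refine e.trans (Finset.sum_congr rfl fun k _ => ?_)
  rw [map_mul, diskEval_apply, diskEval_apply, ← h _ (hA i k), ← h _ (hB k j)]
  rfl

lemma freqResp_map_C {m n : Type*} (A : Matrix m n ℝ) (ω : ℝ≥0∞) :
    freqResp (A.map RatFunc.C) ω = A.map Complex.ofReal := by
  ext i j
  exact freqValue_C _ ω

lemma freqResp_map_C_kronecker_one {N : ℕ} (A : Matrix (Fin N) (Fin N) ℝ) (ω : ℝ≥0∞) :
    freqResp (A.map RatFunc.C ⊗ₖ (1 : Matrix (Fin 2) (Fin 2) TF)) ω =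
      A.map Complex.ofReal ⊗ₖ (1 : Matrix (Fin 2) (Fin 2) ℂ) := by
  ext ⟨i, k⟩ ⟨j, l⟩
  have h0 : freqValue (0 : TF) ω = 0 := by simpa using freqValue_C 0 ω
  by_cases h : k = l
  · subst h; simp [freqResp, freqValue_C]
  · simp [freqResp, h, h0]

lemma isRHInf_map_C_kronecker_one {N : ℕ} (A : Matrix (Fin N) (Fin N) ℝ) :
    IsRHInf (A.map RatFunc.C ⊗ₖ (1 : Matrix (Fin 2) (Fin 2) TF)) := by
  rintro ⟨i, k⟩ ⟨j, l⟩
  refine rhInf.mul_mem (isRHInfEntry_C _) ?_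
  rw [Matrix.one_apply]
  split_ifs
  · exact rhInf.one_mem
  · exact rhInf.zero_mem

lemma dotProduct_freqResp_blockDiag_mulVec {N : ℕ} (A : Fin N → Matrix (Fin 2) (Fin 2) TF)
    (ω : ℝ≥0∞) (x : Fin N × Fin 2 → ℂ) :
    star x ⬝ᵥ freqResp (blockDiag A) ω *ᵥ x =
      ∑ i, star (fun k => x (i, k)) ⬝ᵥ freqResp (A i) ω *ᵥ fun k => x (i, k) := by
  have h0 : freqValue (0 : TF) ω = 0 := by simpa using freqValue_C 0 ω
  have hentry : ∀ i k j l, freqResp (blockDiag A) ω (i, k) (j, l) =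
      if i = j then freqResp (A i) ω k l else 0 := by
    intro i k j l
    by_cases h : i = j
    · subst h; simp [freqResp, blockDiag, Matrix.blockDiagonal_apply]
    · simp [freqResp, blockDiag, Matrix.blockDiagonal_apply, h, h0]
  simp only [dotProduct, Matrix.mulVec, Fintype.sum_prod_type, hentry, ite_mul, zero_mul,
    Pi.star_apply]
  refine Finset.sum_congr rfl fun i _ => Finset.sum_congr rfl fun k _ => ?_
  congr 1
  rw [Finset.sum_eq_single i]
  · simp
  · intro j _ hj; simp [hj.symm]
  · simp

/-- In the rotated coordinates of one converter the rotation cancels from quadratic forms. -/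
lemma dotProduct_freqResp_rot_mulVec {A : Matrix (Fin 2) (Fin 2) TF} (hA : IsRHInf A) (θ : ℝ)
    (ω : ℝ≥0∞) (x : Fin 2 → ℂ) :
    ∃ y : Fin 2 → ℂ, star y ⬝ᵥ y = star x ⬝ᵥ x ∧
      star x ⬝ᵥ freqResp (rot θ * (A * rot (-θ))) ω *ᵥ x = star y ⬝ᵥ freqResp A ω *ᵥ y := by
  set Q := freqResp (rot (-θ)) ω with hQ
  have hadj : freqResp (rot θ) ω = Qᴴ := by
    rw [hQ, rot, rot, freqResp_map_C, freqResp_map_C]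
    ext i j
    fin_cases i <;> fin_cases j <;> simp [-Complex.ofReal_cos, -Complex.ofReal_sin]
  have hunit : Qᴴ * Q = 1 := by
    rw [← hadj, hQ, ← freqResp_mul (isRHInf_rot _) (isRHInf_rot _)]
    have : rot θ * rot (-θ) = 1 := by
      have h := congrArg (RatFunc.C : ℝ →+* TF) (Real.cos_sq_add_sin_sq θ)
      simp only [map_add, map_pow, map_one] at h
      ext i j
      fin_cases i <;> fin_cases j <;> simp [rot, Matrix.mul_apply, Fin.sum_univ_two] <;>
        first | ring1 | linear_combination h
    rw [this]
    ext i j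
    have h0 : freqValue (0 : TF) ω = 0 := by simpa using freqValue_C 0 ω
    have h1 : freqValue (1 : TF) ω = 1 := by simpa using freqValue_C 1 ω
    fin_cases i <;> fin_cases j <;> simp [freqResp, h0, h1]
  refine ⟨Q *ᵥ x, ?_, ?_⟩
  · rw [Matrix.star_mulVec, ← Matrix.dotProduct_mulVec, Matrix.mulVec_mulVec, hunit,
      Matrix.one_mulVec]
  · rw [freqResp_mul (isRHInf_rot _) (hA.mul (isRHInf_rot _)), freqResp_mul hA (isRHInf_rot _),
      hadj, ← hQ, ← Matrix.mulVec_mulVec, ← Matrix.mulVec_mulVec, Matrix.dotProduct_mulVec,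
      ← Matrix.star_mulVec]

lemma re_star_dotProduct_self {n : Type*} [Fintype n] (x : n → ℂ) :
    (star x ⬝ᵥ x).re = ‖(WithLp.toLp 2 x : EuclideanSpace ℂ n)‖ ^ 2 :=
  (congrArg Complex.re (norm_sq_eq_star_dotProduct (WithLp.toLp 2 x))).symm

/-- The quadratic form of `(g I + Bᵀ B) ⊗ I` is real and at least `g ‖x‖ ^ 2`. -/
lemma exists_form_eq_ofReal {N : ℕ} {P B : Matrix (Fin N) (Fin N) ℝ} {g : ℝ}
    (hP : P = g • 1 + Bᵀ * B) (x : Fin N × Fin 2 → ℂ) :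
    ∃ t : ℝ, g * (star x ⬝ᵥ x).re ≤ t ∧
      star x ⬝ᵥ (P.map Complex.ofReal ⊗ₖ (1 : Matrix (Fin 2) (Fin 2) ℂ)) *ᵥ x = t := by
  set C : Matrix (Fin N × Fin 2) (Fin N × Fin 2) ℂ := B.map Complex.ofReal ⊗ₖ 1 with hC
  have hCC : (Bᵀ * B).map Complex.ofReal ⊗ₖ (1 : Matrix (Fin 2) (Fin 2) ℂ) = Cᴴ * C := by
    rw [hC, Matrix.conjTranspose_kronecker, Matrix.conjTranspose_one, ← Matrix.mul_kronecker_mul,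
      Matrix.one_mul]
    congr 1
    ext i j
    simp [Matrix.mul_apply]
  have hPC : P.map Complex.ofReal ⊗ₖ (1 : Matrix (Fin 2) (Fin 2) ℂ) = (g : ℂ) • 1 + Cᴴ * C := by
    rw [← hCC, hP]
    generalize Bᵀ * B = M
    ext ⟨i, k⟩ ⟨j, l⟩
    by_cases hij : i = j <;> by_cases hkl : k = l <;> simp [hij, hkl]
  have hreal : ∀ z : Fin N × Fin 2 → ℂ, star z ⬝ᵥ z = ((star z ⬝ᵥ z).re : ℂ) ∧
      0 ≤ (star z ⬝ᵥ z).re := by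
    intro z
    have h := norm_sq_eq_star_dotProduct (WithLp.toLp 2 z)
    change _ = star z ⬝ᵥ z at h
    rw [← h, Complex.ofReal_re]
    exact ⟨rfl, sq_nonneg _⟩
  refine ⟨g * (star x ⬝ᵥ x).re + (star (C *ᵥ x) ⬝ᵥ (C *ᵥ x)).re,
    le_add_of_nonneg_right (hreal _).2, ?_⟩
  rw [hPC, Matrix.add_mulVec, dotProduct_add, Matrix.smul_mulVec, Matrix.one_mulVec,
    dotProduct_smul, smul_eq_mul, ← Matrix.mulVec_mulVec, Matrix.dotProduct_mulVec _ Cᴴ,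
    ← Matrix.star_mulVec]
  push_cast
  rw [← (hreal x).1, ← (hreal (C *ᵥ x)).1]

/-! ### The decentralized conditions at one frequency -/

section pointwise
variable {N K : ℕ}

/-- Either condition keeps the forms `x* (P ⊗ I) x` and `-τ x* G(jω) x` apart for `x ≠ 0`: the gain
condition makes the second one smaller in modulus, and the phase condition keeps `x* G(jω) x` in a
half-plane that contains no negative real number. -/
lemma form_add_ne_zero (hN : 0 < N) {A : Fin N → Matrix (Fin 2) (Fin 2) TF}
    (hA : ∀ i, IsRHInf (A i)) (θ : Fin N → ℝ) {P B : Matrix (Fin N) (Fin N) ℝ} {g : ℝ}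
    (hg : 0 < g) (hP : P = g • 1 + Bᵀ * B) {ω : ℝ≥0∞}
    (h : (∀ i, maxGain (freqResp (A i) ω) < g) ∨
      ((∀ i, IsSectorial (freqResp (A i) ω)) ∧ (∀ i, maxPhase (freqResp (A i) ω) < Real.pi) ∧
        (∀ i, -Real.pi < minPhase (freqResp (A i) ω)) ∧
        ∀ i j, maxPhase (freqResp (A i) ω) - minPhase (freqResp (A j) ω) < Real.pi))
    {τ : ℝ} (hτ : τ ∈ Set.Icc (0 : ℝ) 1) {x : Fin N × Fin 2 → ℂ} (hx : x ≠ 0) :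
    star x ⬝ᵥ (P.map Complex.ofReal ⊗ₖ (1 : Matrix (Fin 2) (Fin 2) ℂ)) *ᵥ x +
      τ * (star x ⬝ᵥ
        freqResp (blockDiag fun i => rot (θ i) * (A i * rot (-θ i))) ω *ᵥ x) ≠ 0 := by
  have : Nonempty (Fin N) := ⟨⟨0, hN⟩⟩
  obtain ⟨t, hgt, ht⟩ := exists_form_eq_ofReal hP x
  choose y hy hyA using fun i =>
    dotProduct_freqResp_rot_mulVec (hA i) (θ i) ω fun k => x (i, k)
  rw [ht, dotProduct_freqResp_blockDiag_mulVec]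
  simp only [hyA]
  have hxx : star x ⬝ᵥ x = ∑ i, star (y i) ⬝ᵥ y i := by
    simp only [hy]
    simp only [dotProduct, Fintype.sum_prod_type, Pi.star_apply]
  have hpos : 0 < (star x ⬝ᵥ x).re := by
    rw [re_star_dotProduct_self]
    have : (WithLp.toLp 2 x : EuclideanSpace ℂ (Fin N × Fin 2)) ≠ 0 := by simpa using hx
    positivity
  have ht0 : 0 < t := (mul_pos hg hpos).trans_le hgt
  intro h0
  rcases h with h | ⟨hsec, hmax, hmin, hdiff⟩
  · have hbound : ‖∑ i, star (y i) ⬝ᵥ freqResp (A i) ω *ᵥ y i‖ < g * (star x ⬝ᵥ x).re := by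
      have hle : ∀ i, ‖star (y i) ⬝ᵥ freqResp (A i) ω *ᵥ y i‖ ≤
          maxGain (freqResp (A i) ω) * (star (y i) ⬝ᵥ y i).re := fun i =>
        norm_dotProduct_mulVec_le_maxGain _ _
      have hnn : ∀ i, 0 ≤ (star (y i) ⬝ᵥ y i).re := fun i => by
        rw [re_star_dotProduct_self]; positivity
      rw [hxx, Complex.re_sum] at hpos ⊢
      obtain ⟨i, -, hi⟩ := Finset.exists_lt_of_sum_lt (s := Finset.univ)
        (f := fun _ : Fin N => (0 : ℝ)) (g := fun i => (star (y i) ⬝ᵥ y i).re)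
        (by rw [Finset.sum_const_zero]; exact hpos)
      rw [Finset.mul_sum]
      refine (norm_sum_le _ _).trans_lt
        (Finset.sum_lt_sum (fun j _ => ?_) ⟨i, Finset.mem_univ _, ?_⟩)
      · exact (hle j).trans (mul_le_mul_of_nonneg_right (h j).le (hnn j))
      · exact (hle i).trans_lt (mul_lt_mul_of_pos_right (h i) hi)
    have h1 : (t : ℂ) = -((τ : ℂ) * ∑ i, star (y i) ⬝ᵥ freqResp (A i) ω *ᵥ y i) :=
      eq_neg_of_add_eq_zero_left h0
    have h2 := congrArg norm h1
    rw [norm_neg, norm_mul, Complex.norm_real, Complex.norm_real, Real.norm_of_nonneg ht0.le,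
      Real.norm_of_nonneg hτ.1] at h2
    have h3 := mul_le_of_le_one_left (norm_nonneg (∑ i, star (y i) ⬝ᵥ freqResp (A i) ω *ᵥ y i)) hτ.2
    linarith
  · obtain ⟨δ, hδ, hcos⟩ := exists_common_direction _ _ hmax hmin hdiff
    have h1 := congrArg (fun z => (Complex.exp (-(δ * Complex.I)) * z).re) h0
    simp only [mul_zero, Complex.zero_re, mul_add, Complex.add_re] at h1
    rw [mul_left_comm, Complex.re_ofReal_mul, mul_comm, Complex.re_ofReal_mul, Finset.mul_sum,
      Complex.re_sum, show -((δ : ℂ) * Complex.I) = ((-δ : ℝ) : ℂ) * Complex.I by push_cast; ring,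
      Complex.exp_ofReal_mul_I_re, Real.cos_neg] at h1
    have h2 : 0 ≤ ∑ i, (Complex.exp (((-δ : ℝ) : ℂ) * Complex.I) *
        (star (y i) ⬝ᵥ freqResp (A i) ω *ᵥ y i)).re := by
      refine Finset.sum_nonneg fun i _ => ?_
      have := (hsec i).re_exp_mul_nonneg (hcos i) (y i)
      rwa [show -((δ : ℂ) * Complex.I) = ((-δ : ℝ) : ℂ) * Complex.I by push_cast; ring] at this
    have h3 := mul_nonneg hτ.1 h2
    have h4 := mul_pos ht0 hδ
    linarith

end pointwise

end PowerGrid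

end

theorem corollary1 (N K : ℕ) (hN : 0 < N) (net : PowerGrid.RLNetwork N K)
    (ω₀ ε : ℝ) (hω₀ : 0 < ω₀) (hε : net.HasRXRatio ε)
    (S θ : Fin N → ℝ) (hS : ∀ i, 0 < S i)
    (YC : Fin N → Matrix (Fin 2) (Fin 2) PowerGrid.TF)
    (hstable : ∀ i, PowerGrid.IsRHInf (PowerGrid.rescaledConverter ω₀ ε (YC i))) :
    net.gridAdmittance ω₀ =
        Matrix.kronecker (net.reducedLaplacian.map RatFunc.C) (PowerGrid.lineF ω₀ ε) ∧
      IsLeast (net.gridEigenvalues S) (net.gSCR S) ∧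
      net.gSCR S = PowerGrid.minGain
        (PowerGrid.invSqrtDiag S * net.reducedLaplacian * PowerGrid.invSqrtDiag S) ∧
      ((∀ ω : ENNReal, PowerGrid.GainCondition net ω₀ ε S YC ω ∨
          PowerGrid.PhaseCondition ω₀ ε YC ω) →
        PowerGrid.IsStableFeedback (PowerGrid.converterSide ω₀ ε θ YC)
          (PowerGrid.rescaledGrid net ω₀ ε S)⁻¹) := by
  open PowerGrid in
  have hP := scaledLaplacian_posDef net hS
  obtain ⟨g, hg, hleast, hmin, B, hB⟩ := exists_isLeast_spectrum hN hP
  have hgscr : net.gSCR S = g := by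
    rw [RLNetwork.gSCR, gridEigenvalues_eq_spectrum net hS]
    exact hleast.csInf_eq
  refine ⟨net.gridAdmittance_eq ω₀ hε, ?_, hgscr.trans hmin, fun hcond => ?_⟩
  · rw [hgscr, gridEigenvalues_eq_spectrum net hS]
    exact hleast
  rw [converterSide_eq, rescaledGrid_inv_eq net ω₀ hε hS]
  refine isStableFeedback_of_det_ne_zero (isRHInf_blockDiag fun i =>
    (isRHInf_rot _).mul ((hstable i).mul (isRHInf_rot _))) (isRHInf_map_C_kronecker_one _)
    fun ω τ hτ hdet => ?_
  obtain ⟨x, hx, hx0⟩ := Matrix.exists_mulVec_eq_zero_iff.2 hdet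
  refine form_add_ne_zero hN hstable θ hg hB (ω := ω) ?_ hτ hx ?_
  · have := hcond ω
    rwa [GainCondition, hgscr] at this
  -- Multiply `(1 + τ H G) x = 0` by `P ⊗ I = H⁻¹`.
  · have hinv : ((scaledLaplacian net S).map Complex.ofReal ⊗ₖ (1 : Matrix (Fin 2) (Fin 2) ℂ)) *
        ((scaledLaplacian net S)⁻¹.map Complex.ofReal ⊗ₖ 1) = 1 := by
      have h1 : (scaledLaplacian net S).map Complex.ofRealHom *
          (scaledLaplacian net S)⁻¹.map Complex.ofRealHom = 1 := by
        rw [← Matrix.map_mul, Matrix.mul_nonsing_inv _ (isUnit_iff_ne_zero.2 hP.det_pos.ne')]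
        exact Matrix.map_one _ (map_zero _) (map_one _)
      rw [← Matrix.mul_kronecker_mul, Matrix.one_mul]
      exact (congrArg (· ⊗ₖ (1 : Matrix (Fin 2) (Fin 2) ℂ)) h1).trans Matrix.one_kronecker_one
    rw [freqResp_map_C_kronecker_one] at hx0
    have h := congrArg (fun v => star x ⬝ᵥ
      ((scaledLaplacian net S).map Complex.ofReal ⊗ₖ (1 : Matrix (Fin 2) (Fin 2) ℂ)) *ᵥ v) hx0
    simp only [Matrix.mulVec_zero, dotProduct_zero, Matrix.mulVec_mulVec] at h
    rw [Matrix.mul_add, Matrix.mul_one, Matrix.mul_smul, ← Matrix.mul_assoc, hinv, Matrix.one_mul,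
      Matrix.add_mulVec, dotProduct_add, Matrix.smul_mulVec, dotProduct_smul, smul_eq_mul] at h
    exact h
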